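/- Let $V=V_0\oplus V_1$ be a complex superspace with $\dim V_0=k$, $\dim V_1=m$ and $k+m\le 7$. A bilinear form $(\cdot|\cdot)\colon V\times V\to\mathbb C$ is *supersymmetric* if $(a|b)=(-1)^{p(a)p(b)}(b|a)$ for homogeneous $a,b$ of parities $p(a),p(b)$, and *inhomogeneous* if $(V_0|V_1)\neq0$ and $(V_i|V_i)\ne0$ for some $i\in\{0,1\}$. A *pre-oscillator form* is an inhomogeneous supersymmetric bilinear form whose restrictions to $V_0$ and to $V_1$ are nondegenerate. A form is *reducible* if $V=U\oplus W$ for nonzero subsuperspaces $U,W$ with $(U|W)=0$, and *irreducible* otherwise; a subsuperspace is a subspace $U$ with $U=(U\cap V_0)\oplus(U\cap V_1)$. Two forms $(\cdot|\cdot)_1,(\cdot|\cdot)_2$ on $V$ are *equivalent* if there is a linear automorphism $\varphi$ of $V$ with $\varphi(V_0)=V_0$, $\varphi(V_1)=V_1$ and $(\varphi u|\varphi v)_1=(u|v)_2$ for all $u,v\in V$. Fix a basis of $V_0$ and a basis of $V_1$. For $B\in\mathbb C^{k\times m}$ let $(\cdot|\cdot)_B$ be the form on $V$ with Gram matrix $$\begin{pmatrix}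 I_k & B\\ B^T & J_m\end{pmatrix},\qquad J_m=\operatorname{diag}(J,\dots,J),\quad J=\begin{pmatrix}0&1\\-1&0\end{pmatrix}$$ in these bases when $m$ is even. Let $\mathbb C^+=\{\gamma\in\mathbb C:\operatorname{Re}\gamma>0,\text{ or }\operatorname{Re}\gamma=0\text{ and }\operatorname{Im}\gamma>0\}$, and consider the following list of matrices $B$, by $(k|m)$: - $(1|2)$: $B_1=\begin{pmatrix}1&0\end{pmatrix}$; - $(2|2)$: $B_{2,\alpha}=\begin{pmatrix}1&0\\0&\alpha\end{pmatrix}$ for $\alpha\in\mathbb C^+$, and $B_3=\begin{pmatrix}1&0\\ i&0\end{pmatrix}$; - $(3|2)$: $B_4=\begin{pmatrix}1&0\\0&1\\0&i\end{pmatrix}$; - $(3|4)$: $B_5=\begin{pmatrix}1&0&0&0\\0&1&1&0\\0&0&0&i\end{pmatrix}$; - $(4|2)$: $B_6=\begin{pmatrix}1&0\\ i&0\\0&1\\0&i\end{pmatrix}$; - no matrix for any other $(k|m)$. **Theorem.** 1. A bilinear form on $V$ is an irreducible pre-oscillator form if and only if it is equivalent to $(\cdot|\cdot)_B$ for some listed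 $B$ of size $k\times m$. In particular every listed form is an irreducible pre-oscillator form. 2. For distinct listed matrices $B\neq B'$ of size $k\times m$, the forms $(\cdot|\cdot)_B$ and $(\cdot|\cdot)_{B'}$ are inequivalent. 3. A bilinear form on $V$ is a pre-oscillator form if and only if $m$ is even and the form is equivalent to $(\cdot|\cdot)_B$ for some $B\in\mathbb C^{k\times m}$, $B\ne0$. 4. If $m$ is even, then for all $B,B'\in\mathbb C^{k\times m}$ the forms $(\cdot|\cdot)_B$ and $(\cdot|\cdot)_{B'}$ are equivalent if and only if $B'=X^TBY$ for some $X\in \mathrm{GL}(k,\mathbb C)$ with $X^TX=I_k$ and $Y\in \mathrm{GL}(m,\mathbb C)$ with $Y^TJ_mY=J_m$. -/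

import Mathlib

open scoped Matrix

noncomputable section

namespace SuperForm

section Superspace

variable {V : Type*} [AddCommGroup V] [Module ℂ V]

/-- Supersymmetry of a bilinear form on `V = V₀ ⊕ V₁`:
`(a|b) = (-1)^{p(a)p(b)} (b|a)` for homogeneous `a`, `b`. -/
structure IsSupersymmetric (V₀ V₁ : Submodule ℂ V) (β : LinearMap.BilinForm ℂ V) : Prop where
  even_even : ∀ a ∈ V₀, ∀ b ∈ V₀, β a b = β b a
  even_odd : ∀ a ∈ V₀, ∀ b ∈ V₁, β a b = β b a
  odd_odd : ∀ a ∈ V₁, ∀ b ∈ V₁, β a b = -β b a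

/-- `(V₀|V₁) ≠ 0`, and `(V₀|V₀) ≠ 0` or `(V₁|V₁) ≠ 0`. -/
def IsInhomogeneous (V₀ V₁ : Submodule ℂ V) (β : LinearMap.BilinForm ℂ V) : Prop :=
  (∃ a ∈ V₀, ∃ b ∈ V₁, β a b ≠ 0) ∧
    ((∃ a ∈ V₀, ∃ b ∈ V₀, β a b ≠ 0) ∨ (∃ a ∈ V₁, ∃ b ∈ V₁, β a b ≠ 0))

/-- Pre-oscillator forms: inhomogeneous supersymmetric bilinear forms whose restrictions to
the even part and to the odd part are nondegenerate. -/
structure IsPreOscillator (V₀ V₁ : Submodule ℂ V) (β : LinearMap.BilinForm ℂ V) : Prop where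
  supersymmetric : IsSupersymmetric V₀ V₁ β
  inhomogeneous : IsInhomogeneous V₀ V₁ β
  nondegenerate_even : (β.restrict V₀).Nondegenerate
  nondegenerate_odd : (β.restrict V₁).Nondegenerate

/-- A subsuperspace is a subspace that is the sum of its even and odd parts. -/
def IsSubsuperspace (V₀ V₁ U : Submodule ℂ V) : Prop :=
  U = (U ⊓ V₀) ⊔ (U ⊓ V₁)

/-- `V` is an orthogonal direct sum of two nonzero subsuperspaces. -/
def IsReducible (V₀ V₁ : Submodule ℂ V) (β : LinearMap.BilinForm ℂ V) : Prop :=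
  ∃ U W : Submodule ℂ V, IsSubsuperspace V₀ V₁ U ∧ IsSubsuperspace V₀ V₁ W ∧
    U ≠ ⊥ ∧ W ≠ ⊥ ∧ IsCompl U W ∧ ∀ u ∈ U, ∀ w ∈ W, β u w = 0

def IsIrreducible (V₀ V₁ : Submodule ℂ V) (β : LinearMap.BilinForm ℂ V) : Prop :=
  ¬ IsReducible V₀ V₁ β

/-- Equivalence of two forms on the same superspace: there is an even automorphism `φ` with
`(φ u|φ v)₁ = (u|v)₂` for all `u`, `v`. -/
def FormEquiv (V₀ V₁ : Submodule ℂ V) (β₁ β₂ : LinearMap.BilinForm ℂ V) : Prop :=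
  ∃ φ : V ≃ₗ[ℂ] V, V₀.map (φ : V →ₗ[ℂ] V) = V₀ ∧ V₁.map (φ : V →ₗ[ℂ] V) = V₁ ∧
    ∀ u v : V, β₁ (φ u) (φ v) = β₂ u v

end Superspace

/-- `J_m = diag(J, …, J)` with `J = [0, 1; -1, 0]`, for even `m`
(rows and columns are numbered from `0`). -/
def blockJ (m : ℕ) : Matrix (Fin m) (Fin m) ℂ :=
  Matrix.of fun i j =>
    if i.val % 2 = 0 ∧ j.val = i.val + 1 then 1
    else if j.val % 2 = 0 ∧ i.val = j.val + 1 then -1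
    else 0

/-- `B` and `B'` lie in the same orbit of the right action `B · (X, Y) = Xᵀ B Y` of
`O(k) × Sp(m)`. -/
def SameOrbit {k m : ℕ} (B B' : Matrix (Fin k) (Fin m) ℂ) : Prop :=
  ∃ (X : Matrix (Fin k) (Fin k) ℂ) (Y : Matrix (Fin m) (Fin m) ℂ),
    Xᵀ * X = 1 ∧ IsUnit Y ∧ Yᵀ * blockJ m * Y = blockJ m ∧ B' = Xᵀ * B * Y

/-- The form on `V = V₀ ⊕ V₁` with Gram matrix `[1, B; Bᵀ, J_m]` in the homogeneous basis
of `V` formed by a basis `e` of `V₀` and a basis `f` of `V₁`. -/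
def gramForm {V : Type*} [AddCommGroup V] [Module ℂ V] {V₀ V₁ : Submodule ℂ V}
    (hV : IsCompl V₀ V₁) {k m : ℕ} (e : Module.Basis (Fin k) ℂ V₀)
    (f : Module.Basis (Fin m) ℂ V₁) (B : Matrix (Fin k) (Fin m) ℂ) :
    LinearMap.BilinForm ℂ V :=
  Matrix.toBilin ((e.prod f).map (Submodule.prodEquivOfIsCompl V₀ V₁ hV))
    (Matrix.fromBlocks 1 B Bᵀ (blockJ m))

/-- `ℂ⁺`: a set of representatives of the nonzero complex numbers modulo sign. -/
def CPlus : Set ℂ := {γ | 0 < γ.re ∨ (γ.re = 0 ∧ 0 < γ.im)}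

/-- The table: `IsListed k m B` says that `B` is one of the representatives listed for
even dimension `k` and odd dimension `m`. -/
inductive IsListed : (k m : ℕ) → Matrix (Fin k) (Fin m) ℂ → Prop
  | B₁ : IsListed 1 2 !![1, 0]
  | B₂ (α : ℂ) (hα : α ∈ CPlus) : IsListed 2 2 !![1, 0; 0, α]
  | B₃ : IsListed 2 2 !![1, 0; Complex.I, 0]
  | B₄ : IsListed 3 2 !![1, 0; 0, 1; 0, Complex.I]
  | B₅ : IsListed 3 4 !![1, 0, 0, 0; 0, 1, 1, 0; 0, 0, 0, Complex.I]
  | B₆ : IsListed 4 2 !![1, 0; Complex.I, 0; 0, 1; 0, Complex.I]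

end SuperForm

end

open scoped Matrix

noncomputable section

namespace SuperForm

open Module

/-! ### Symplectic and orthonormal families over `ℂ` -/

section Families

variable {V : Type*} [AddCommGroup V] [Module ℂ V]

/-! Over `ℂ` a nondegenerate symmetric form has an orthonormal basis and a nondegenerate alternating
form a symplectic one, which also forces even dimension. Hence a pre-oscillator form is determined
by its mixed block `B`, and the remaining freedom in the two bases is the action of `O(k) × Sp(m)`.

For the classification, write β(x, y) = h(x, y) + h(Dx, y), where h is the parity-preserving part of
β and D is an odd operator. D is h-selfadjoint on `V₀` and anti-selfadjoint on `V₁`, so D² is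
h-skew. A homogeneous D-stable subspace on which h is nondegenerate splits off, so in an irreducible
form it is zero or everything (`eq_top_of_nondegenerate`). Applied to the Fitting decomposition of
D², this makes D nilpotent or injective (`isNilpotent_or_injective`).

If D is injective, then k = m is even, nonzero and 2k ≤ 7, so k = m = 2. Since Sp(2) = SL(2), an
invertible B is classified by det B up to sign: the family `B₂`.

If D is nilpotent, let n be the last exponent with D^n ≠ 0. The pairing h(x, D^n y) is nonzero, and
its symmetry type depends on n mod 4: odd n pairs `V₀` with `V₁`; n ≡ 0 gives a symmetric pairing on
`V₀` and a skew one on `V₁`; n ≡ 2 exchanges the two. Moreover rank(D^n)·(n + 1) ≤ 7, so n ≤ 6, and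
the rank is 1 once n ≥ 3, which leaves only symmetric pairings there. One Jordan chain (symmetric
case) or two (otherwise), normalised, then span a nondegenerate D-stable subspace, hence V. This
gives `B₃` (n = 1), `B₁` or `B₆` (n = 2), `B₄` (n = 4) and `B₅` (n = 6).

Conversely, `B₅` gives a single Jordan block, whose kernel line lies in every nonzero D-stable
subspace; for the other matrices m = 2, and irreducibility follows because the left kernel of B is
isotropic. Determinants separate the matrices of size (2|2), the only size with more than one entry.
-/

theorem blockJ_succ_succ (m : ℕ) (i j : Fin m) :
    blockJ (m + 2) i.succ.succ j.succ.succ = blockJ m i j := by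
  simp only [blockJ, Matrix.of_apply, Fin.val_succ, add_assoc, Nat.reduceAdd, Nat.add_mod_right,
    Nat.add_right_cancel_iff]

theorem blockJ_mul_blockJ {m : ℕ} (hm : Even m) : blockJ m * blockJ m = -1 := by
  obtain ⟨r, rfl⟩ := hm
  ext i j
  rw [Matrix.mul_apply]
  obtain ⟨i, hi⟩ := i
  obtain ⟨j, hj⟩ := j
  rcases Nat.mod_two_eq_zero_or_one i with h | h
  -- Row `i` has a single nonzero entry, in column `i + 1` for even `i` and `i - 1` for odd `i`;
  -- evenness of the size keeps `i + 1` in range.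
  · rw [Finset.sum_eq_single (⟨i + 1, by omega⟩ : Fin (r + r))]
    · simp only [blockJ, Matrix.of_apply, Matrix.neg_apply, Matrix.one_apply, Fin.mk.injEq]
      split_ifs <;> grind
    · rintro ⟨l, hl⟩ - hne
      simp only [ne_eq, Fin.mk.injEq] at hne
      simp only [blockJ, Matrix.of_apply]
      rw [if_neg (by omega), if_neg (by omega), zero_mul]
    · simp
  · rw [Finset.sum_eq_single (⟨i - 1, by omega⟩ : Fin (r + r))]
    · simp only [blockJ, Matrix.of_apply, Matrix.neg_apply, Matrix.one_apply, Fin.mk.injEq]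
      split_ifs <;> grind
    · rintro ⟨l, hl⟩ - hne
      simp only [ne_eq, Fin.mk.injEq] at hne
      simp only [blockJ, Matrix.of_apply]
      rw [if_neg (by omega), if_neg (by omega), zero_mul]
    · simp

theorem linearIndependent_of_gram {ι : Type*} [Fintype ι] [DecidableEq ι]
    (β : LinearMap.BilinForm ℂ V) (b : ι → V) (G G' : Matrix ι ι ℂ) (hG : G * G' = 1)
    (h : ∀ i j, β (b i) (b j) = G i j) : LinearIndependent ℂ b := by
  rw [Fintype.linearIndependent_iff]
  intro a ha
  have h0 : a ᵥ* G = 0 := by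
    ext j
    have := congrArg (fun x => β x (b j)) ha
    simpa [h, Matrix.vecMul, dotProduct] using this
  have : a ᵥ* (G * G') = 0 := by rw [← Matrix.vecMul_vecMul, h0, Matrix.zero_vecMul]
  rw [hG, Matrix.vecMul_one] at this
  exact fun i => congrFun this i

/-- Split off a hyperbolic plane spanned by `u`, `v` and induct on its orthogonal complement, the
kernel of (ω u, ω v), which has codimension 2 and is again nondegenerate. -/
theorem exists_symplectic_family (n : ℕ) : ∀ {W : Type _} [AddCommGroup W] [Module ℂ W]
    [FiniteDimensional ℂ W] (ω : LinearMap.BilinForm ℂ W) (_ : ∀ x y, ω x y = -ω y x)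
    (_ : ∀ x, (∀ y, ω x y = 0) → x = 0) (_ : finrank ℂ W = n),
    Even n ∧ ∃ f : Fin n → W, ∀ i j, ω (f i) (f j) = blockJ n i j := by
  induction n using Nat.strong_induction_on with
  | _ n ih =>
  intro W _ _ _ ω hω nd hn
  have hself : ∀ x, ω x x = 0 := fun x => self_eq_neg.mp (hω x x)
  rcases Nat.eq_zero_or_pos n with rfl | hpos
  · exact ⟨Even.zero, fun i => i.elim0, fun i => i.elim0⟩
  have : Nontrivial W := Module.nontrivial_of_finrank_pos (R := ℂ) (hn ▸ hpos)
  obtain ⟨u, hu⟩ := exists_ne (0 : W)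
  obtain ⟨v₀, hv₀⟩ : ∃ v, ω u v ≠ 0 := by
    by_contra! h
    exact hu (nd u h)
  obtain ⟨v, huv⟩ : ∃ v, ω u v = 1 := ⟨(ω u v₀)⁻¹ • v₀, by simp [hv₀]⟩
  have hvu : ω v u = -1 := by rw [hω, huv]
  let L : W →ₗ[ℂ] ℂ × ℂ := (ω u).prod (ω v)
  have hL : ∀ y, y - (-ω v y) • u - (ω u y) • v ∈ LinearMap.ker L := by
    intro y
    simp [L, huv, hvu, hself]
  have hsurj : LinearMap.range L = ⊤ := by
    rw [LinearMap.range_eq_top]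
    rintro ⟨a, b⟩
    exact ⟨(-b) • u + a • v, by simp [L, huv, hvu, hself]⟩
  have hdim := L.finrank_range_add_finrank_ker
  rw [hsurj, finrank_top, hn] at hdim
  simp only [finrank_prod, finrank_self] at hdim
  obtain ⟨hev, f, hf⟩ := ih (finrank ℂ (LinearMap.ker L)) (by omega)
    (ω.restrict (LinearMap.ker L)) (fun x y => hω x y) (by
      rintro ⟨x, hx⟩ h
      have hx' : ω u x = 0 ∧ ω v x = 0 := by simpa [L] using hx
      refine Subtype.ext (nd x fun y => ?_)
      have h1 := h ⟨_, hL y⟩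
      simp only [LinearMap.BilinForm.restrict_apply] at h1
      rw [LinearMap.domRestrict_apply, map_sub, map_sub, map_smul, map_smul, hω x u, hω x v,
        hx'.1, hx'.2] at h1
      simpa using h1) rfl
  generalize finrank ℂ (LinearMap.ker L) = n' at *
  obtain rfl : n = n' + 2 := by omega
  refine ⟨by simpa [Nat.even_add] using hev, Fin.cons u (Fin.cons v fun i => (f i : W)), ?_⟩
  have h0 : ∀ i, ω u (f i) = 0 ∧ ω v (f i) = 0 := fun i => by
    simpa [L] using (f i).2
  have h1 : ∀ i, ω (f i) u = 0 ∧ ω (f i) v = 0 := fun i => by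
    rw [hω _ u, hω _ v, (h0 i).1, (h0 i).2]; simp
  intro i j
  refine Fin.cases ?_ (fun i => Fin.cases ?_ (fun i => ?_) i) i <;>
  refine Fin.cases ?_ (fun j => Fin.cases ?_ (fun j => ?_) j) j
  · simp [blockJ, hself]
  · simp [blockJ, huv]
  · simp [blockJ, h0]
  · simp [blockJ, hvu]
  · simp [blockJ, hself]
  · simp [blockJ, h0]
  · simp [blockJ, h1]
  · simp [blockJ, h1]
  · rw [blockJ_succ_succ]
    exact hf i j

/-- Nondegeneracy excludes isotropic vectors from an orthogonal basis, so each can be divided by a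
square root of its norm. -/
theorem exists_orthonormal_family {W : Type*} [AddCommGroup W] [Module ℂ W]
    [FiniteDimensional ℂ W] (g : LinearMap.BilinForm ℂ W) (hg : ∀ x y, g x y = g y x)
    (nd : ∀ x, (∀ y, g x y = 0) → x = 0) {n : ℕ} (hn : finrank ℂ W = n) :
    ∃ e : Fin n → W, ∀ i j, g (e i) (e j) = (1 : Matrix (Fin n) (Fin n) ℂ) i j := by
  subst hn
  have : Invertible (2 : ℂ) := invertibleOfNonzero two_ne_zero
  obtain ⟨v, hv⟩ := LinearMap.BilinForm.exists_orthogonal_basis (B := g) ⟨hg⟩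
  have hv' : ∀ i j, i ≠ j → g (v i) (v j) = 0 := fun i j hij => hv hij
  have hne : ∀ i, g (v i) (v i) ≠ 0 := fun i hi => v.ne_zero i <| nd _ fun y => by
    have : g (v i) = 0 := v.ext fun j => by
      rcases eq_or_ne i j with rfl | hij
      · simpa using hi
      · simpa using hv' i j hij
    rw [this]; rfl
  choose s hs using fun i => IsAlgClosed.exists_pow_nat_eq (g (v i) (v i)) (n := 2) two_pos
  refine ⟨fun i => (s i)⁻¹ • v i, fun i j => ?_⟩
  rcases eq_or_ne i j with rfl | hij
  · have : s i ≠ 0 := fun h => hne i (by rw [← hs, h]; simp)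
    simp only [map_smul, LinearMap.smul_apply, smul_eq_mul, Matrix.one_apply_eq, ← hs]
    field_simp
  · simp [hv' i j hij, Matrix.one_apply_ne hij]

end Families

/-! ### Forms given by a Gram matrix -/

section GramForm

variable {V : Type*} [AddCommGroup V] [Module ℂ V] {V₀ V₁ : Submodule ℂ V}
  (hV : IsCompl V₀ V₁) {k m : ℕ} (e : Basis (Fin k) ℂ V₀) (f : Basis (Fin m) ℂ V₁)
  (B : Matrix (Fin k) (Fin m) ℂ)

/-- The homogeneous basis of `V` formed by a basis of `V₀` and a basis of `V₁`. -/
def homogeneousBasis : Basis (Fin k ⊕ Fin m) ℂ V :=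
  (e.prod f).map (Submodule.prodEquivOfIsCompl V₀ V₁ hV)

@[simp]
theorem homogeneousBasis_inl (i : Fin k) : homogeneousBasis hV e f (Sum.inl i) = e i := by
  simp [homogeneousBasis]

@[simp]
theorem homogeneousBasis_inr (i : Fin m) : homogeneousBasis hV e f (Sum.inr i) = f i := by
  simp [homogeneousBasis]

theorem gramForm_basis (i j : Fin k ⊕ Fin m) :
    gramForm hV e f B (homogeneousBasis hV e f i) (homogeneousBasis hV e f j) =
      Matrix.fromBlocks 1 B Bᵀ (blockJ m) i j := by
  have h := LinearMap.BilinForm.toMatrix_toBilin (homogeneousBasis hV e f)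
    (Matrix.fromBlocks 1 B Bᵀ (blockJ m))
  have h' := congrFun (congrFun h i) j
  rwa [LinearMap.BilinForm.toMatrix_apply] at h'

@[simp]
theorem gramForm_even_even (i j : Fin k) :
    gramForm hV e f B (e i) (e j) = (1 : Matrix (Fin k) (Fin k) ℂ) i j := by
  simpa using gramForm_basis hV e f B (Sum.inl i) (Sum.inl j)

@[simp]
theorem gramForm_even_odd (i : Fin k) (j : Fin m) : gramForm hV e f B (e i) (f j) = B i j := by
  simpa using gramForm_basis hV e f B (Sum.inl i) (Sum.inr j)

@[simp]
theorem gramForm_odd_even (i : Fin m) (j : Fin k) : gramForm hV e f B (f i) (e j) = B j i := by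
  simpa using gramForm_basis hV e f B (Sum.inr i) (Sum.inl j)

@[simp]
theorem gramForm_odd_odd (i j : Fin m) : gramForm hV e f B (f i) (f j) = blockJ m i j := by
  simpa using gramForm_basis hV e f B (Sum.inr i) (Sum.inr j)

/-- Two bilinear maps agree on `p × q` when they agree on bases of `p` and `q`. -/
theorem bilin_eqOn_of_basis {ι κ : Type*} {p q : Submodule ℂ V} (b : Basis ι ℂ p)
    (c : Basis κ ℂ q) (β γ : V →ₗ[ℂ] V →ₗ[ℂ] ℂ)
    (h : ∀ i j, β (b i) (c j) = γ (b i) (c j)) : ∀ x ∈ p, ∀ y ∈ q, β x y = γ x y := by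
  have : β.domRestrict₁₂ p q = γ.domRestrict₁₂ p q :=
    LinearMap.ext_basis b c h
  intro x hx y hy
  exact LinearMap.congr_fun₂ this ⟨x, hx⟩ ⟨y, hy⟩

theorem blockJ_transpose (m : ℕ) (i j : Fin m) : blockJ m i j = -blockJ m j i := by
  simp only [blockJ, Matrix.of_apply]
  split_ifs <;> grind

theorem isSupersymmetric_gramForm : IsSupersymmetric V₀ V₁ (gramForm hV e f B) where
  even_even := bilin_eqOn_of_basis e e _ (gramForm hV e f B).flip fun i j => by
    simp [Matrix.one_apply, eq_comm]
  even_odd := bilin_eqOn_of_basis e f _ (gramForm hV e f B).flip fun i j => by simp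
  odd_odd := bilin_eqOn_of_basis f f _ (-(gramForm hV e f B).flip) fun i j => by
    simp [blockJ_transpose m i j]

theorem isPreOscillator_gramForm (hm : Even m) (hB : B ≠ 0) :
    IsPreOscillator V₀ V₁ (gramForm hV e f B) := by
  have hs := isSupersymmetric_gramForm hV e f B
  refine ⟨hs, ?_, ?_, ?_⟩
  · obtain ⟨i, j, hij⟩ : ∃ i j, B i j ≠ 0 := by
      by_contra! h
      exact hB (Matrix.ext h)
    exact ⟨⟨e i, (e i).2, f j, (f j).2, by simpa using hij⟩,
      Or.inl ⟨e i, (e i).2, e i, (e i).2, by simp⟩⟩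
  · have : LinearMap.BilinForm.toMatrix e ((gramForm hV e f B).restrict V₀) = 1 := by
      ext i j
      rw [LinearMap.BilinForm.toMatrix_apply]
      exact gramForm_even_even hV e f B i j
    rw [LinearMap.BilinForm.nondegenerate_iff_det_ne_zero e, this]
    simp
  · have : LinearMap.BilinForm.toMatrix f ((gramForm hV e f B).restrict V₁) = blockJ m := by
      ext i j
      rw [LinearMap.BilinForm.toMatrix_apply]
      exact gramForm_odd_odd hV e f B i j
    rw [LinearMap.BilinForm.nondegenerate_iff_det_ne_zero f, this]
    intro h
    have h2 := congrArg Matrix.det (blockJ_mul_blockJ hm)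
    rw [Matrix.det_mul, h, Matrix.det_neg] at h2
    simp only [mul_zero, Fintype.card_fin, Matrix.det_one, mul_one] at h2
    exact pow_ne_zero m (neg_ne_zero.mpr one_ne_zero) h2.symm

variable {e f} in
/-- A supersymmetric form is determined by its values on a homogeneous basis. -/
theorem IsSupersymmetric.ext_basis {β γ : LinearMap.BilinForm ℂ V}
    (hβ : IsSupersymmetric V₀ V₁ β) (hγ : IsSupersymmetric V₀ V₁ γ)
    (h00 : ∀ i j, β (e i) (e j) = γ (e i) (e j)) (h01 : ∀ i j, β (e i) (f j) = γ (e i) (f j))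
    (h11 : ∀ i j, β (f i) (f j) = γ (f i) (f j)) (hV : IsCompl V₀ V₁) : β = γ := by
  refine LinearMap.ext_basis (homogeneousBasis hV e f) (homogeneousBasis hV e f) fun i j => ?_
  rcases i with i | i <;> rcases j with j | j <;>
    simp only [homogeneousBasis_inl, homogeneousBasis_inr]
  · exact h00 i j
  · exact h01 i j
  · rw [← hβ.even_odd _ (e j).2 _ (f i).2, ← hγ.even_odd _ (e j).2 _ (f i).2, h01]
  · exact h11 i j

end GramForm

/-! ### Invariance under equivalence -/

section Equiv

variable {V : Type*} [AddCommGroup V] [Module ℂ V] {V₀ V₁ : Submodule ℂ V}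
  {β γ : LinearMap.BilinForm ℂ V}

theorem FormEquiv.symm (h : FormEquiv V₀ V₁ β γ) : FormEquiv V₀ V₁ γ β := by
  obtain ⟨φ, h0, h1, h⟩ := h
  refine ⟨φ.symm, ?_, ?_, fun u v => by simp [← h]⟩
  · conv_lhs => rw [← h0]
    rw [← Submodule.map_comp]; simp
  · conv_lhs => rw [← h1]
    rw [← Submodule.map_comp]; simp

theorem FormEquiv.trans {δ : LinearMap.BilinForm ℂ V} (h : FormEquiv V₀ V₁ β γ)
    (h' : FormEquiv V₀ V₁ γ δ) : FormEquiv V₀ V₁ β δ := by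
  obtain ⟨φ, h0, h1, h⟩ := h
  obtain ⟨ψ, g0, g1, g⟩ := h'
  refine ⟨ψ.trans φ, ?_, ?_, fun u v => by simp [h, g]⟩
  · rw [LinearEquiv.coe_trans, Submodule.map_comp, g0, h0]
  · rw [LinearEquiv.coe_trans, Submodule.map_comp, g1, h1]

theorem mem_map_iff_of_map_eq {U : Submodule ℂ V} {φ : V ≃ₗ[ℂ] V}
    (h : U.map (φ : V →ₗ[ℂ] V) = U) (x : V) : φ x ∈ U ↔ x ∈ U := by
  conv_lhs => rw [← h]
  simp

theorem IsSupersymmetric.of_equiv (h : FormEquiv V₀ V₁ β γ) (hβ : IsSupersymmetric V₀ V₁ β) :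
    IsSupersymmetric V₀ V₁ γ := by
  obtain ⟨φ, h0, h1, h⟩ := h
  have m0 := fun x => (mem_map_iff_of_map_eq h0 x).2
  have m1 := fun x => (mem_map_iff_of_map_eq h1 x).2
  refine ⟨fun a ha b hb => ?_, fun a ha b hb => ?_, fun a ha b hb => ?_⟩ <;> rw [← h, ← h]
  · exact hβ.even_even _ (m0 _ ha) _ (m0 _ hb)
  · exact hβ.even_odd _ (m0 _ ha) _ (m1 _ hb)
  · exact hβ.odd_odd _ (m1 _ ha) _ (m1 _ hb)

theorem restrict_nondegenerate_of_equiv {U : Submodule ℂ V} {φ : V ≃ₗ[ℂ] V}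
    (hφ : U.map (φ : V →ₗ[ℂ] V) = U) (h : ∀ u v, β (φ u) (φ v) = γ u v)
    (nd : (β.restrict U).Nondegenerate) : (γ.restrict U).Nondegenerate := by
  have key : ∀ x : U, φ x ∈ U := fun x => (mem_map_iff_of_map_eq hφ x).2 x.2
  have key' : ∀ x : U, φ.symm x ∈ U := fun x => (mem_map_iff_of_map_eq hφ _).1 (by simp)
  constructor
  · intro x hx
    have := nd.1 ⟨φ x, key x⟩ fun y => by
      have h2 := hx ⟨φ.symm y, key' y⟩
      simpa [← h, LinearMap.domRestrict_apply] using h2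
    simpa using this
  · intro x hx
    have := nd.2 ⟨φ x, key x⟩ fun y => by
      have h2 := hx ⟨φ.symm y, key' y⟩
      simpa [← h, LinearMap.domRestrict_apply] using h2
    simpa using this

theorem IsPreOscillator.of_equiv (h : FormEquiv V₀ V₁ β γ) (hβ : IsPreOscillator V₀ V₁ β) :
    IsPreOscillator V₀ V₁ γ := by
  have hs := hβ.supersymmetric.of_equiv h
  obtain ⟨φ, h0, h1, h⟩ := h
  refine ⟨hs, ?_, restrict_nondegenerate_of_equiv h0 h hβ.nondegenerate_even,
    restrict_nondegenerate_of_equiv h1 h hβ.nondegenerate_odd⟩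
  have m0 : ∀ x ∈ V₀, φ.symm x ∈ V₀ := fun x hx => (mem_map_iff_of_map_eq h0 _).1 (by simpa)
  have m1 : ∀ x ∈ V₁, φ.symm x ∈ V₁ := fun x hx => (mem_map_iff_of_map_eq h1 _).1 (by simpa)
  have hg : ∀ u v, γ (φ.symm u) (φ.symm v) = β u v := fun u v => by simp [← h]
  obtain ⟨⟨a, ha, b, hb, hab⟩, h3⟩ := hβ.inhomogeneous
  refine ⟨⟨_, m0 a ha, _, m1 b hb, by rwa [hg]⟩, ?_⟩
  rcases h3 with ⟨a, ha, b, hb, hab⟩ | ⟨a, ha, b, hb, hab⟩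
  · exact Or.inl ⟨_, m0 a ha, _, m0 b hb, by rwa [hg]⟩
  · exact Or.inr ⟨_, m1 a ha, _, m1 b hb, by rwa [hg]⟩

theorem IsSubsuperspace.map {U : Submodule ℂ V} (hU : IsSubsuperspace V₀ V₁ U) {φ : V ≃ₗ[ℂ] V}
    (h0 : V₀.map (φ : V →ₗ[ℂ] V) = V₀) (h1 : V₁.map (φ : V →ₗ[ℂ] V) = V₁) :
    IsSubsuperspace V₀ V₁ (U.map (φ : V →ₗ[ℂ] V)) := by
  have hinf : ∀ W : Submodule ℂ V, (U ⊓ W).map (φ : V →ₗ[ℂ] V) =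
      U.map (φ : V →ₗ[ℂ] V) ⊓ W.map (φ : V →ₗ[ℂ] V) := fun W =>
    Submodule.map_inf _ φ.injective
  unfold IsSubsuperspace
  conv_lhs => rw [hU]
  rw [Submodule.map_sup, hinf, hinf, h0, h1]

theorem IsReducible.of_equiv (h : FormEquiv V₀ V₁ β γ) (hγ : IsReducible V₀ V₁ γ) :
    IsReducible V₀ V₁ β := by
  obtain ⟨φ, h0, h1, h⟩ := h
  obtain ⟨U, W, hU, hW, hU0, hW0, hUW, ho⟩ := hγ
  refine ⟨U.map (φ : V →ₗ[ℂ] V), W.map (φ : V →ₗ[ℂ] V), hU.map h0 h1, hW.map h0 h1, ?_, ?_, ?_,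
    ?_⟩
  · simpa [Submodule.map_eq_bot_iff] using hU0
  · simpa [Submodule.map_eq_bot_iff] using hW0
  · exact hUW.map (Submodule.orderIsoMapComap φ)
  · rintro _ ⟨u, hu, rfl⟩ _ ⟨w, hw, rfl⟩
    simpa [h] using ho u hu w hw

theorem IsIrreducible.of_equiv (h : FormEquiv V₀ V₁ β γ) (hβ : IsIrreducible V₀ V₁ β) :
    IsIrreducible V₀ V₁ γ := fun hγ => hβ (hγ.of_equiv h)

end Equiv

/-! ### Reduction to orbits of `O(k) × Sp(m)` -/

section Recognition

variable {V : Type*} [AddCommGroup V] [Module ℂ V] {V₀ V₁ : Submodule ℂ V}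
  {k m : ℕ} (e : Basis (Fin k) ℂ V₀) (f : Basis (Fin m) ℂ V₁)

theorem formEquiv_of_bases (hV : IsCompl V₀ V₁) (e' : Basis (Fin k) ℂ V₀) (f' : Basis (Fin m) ℂ V₁)
    {β γ : LinearMap.BilinForm ℂ V} (hβ : IsSupersymmetric V₀ V₁ β)
    (hγ : IsSupersymmetric V₀ V₁ γ)
    (h00 : ∀ i j, β (e' i) (e' j) = γ (e i) (e j)) (h01 : ∀ i j, β (e' i) (f' j) = γ (e i) (f j))
    (h11 : ∀ i j, β (f' i) (f' j) = γ (f i) (f j)) : FormEquiv V₀ V₁ β γ := by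
  let P := Submodule.prodEquivOfIsCompl V₀ V₁ hV
  let ε := e.equiv e' (Equiv.refl _)
  let ζ := f.equiv f' (Equiv.refl _)
  let φ : V ≃ₗ[ℂ] V := (P.symm.trans (ε.prodCongr ζ)).trans P
  have hφ0 : ∀ x : V₀, φ x = ε x := fun x => by simp [φ, P]
  have hφ1 : ∀ x : V₁, φ x = ζ x := fun x => by simp [φ, P]
  have m0 : V₀.map (φ : V →ₗ[ℂ] V) = V₀ := by
    ext y
    constructor
    · rintro ⟨x, hx, rfl⟩
      simpa using (hφ0 ⟨x, hx⟩) ▸ (ε ⟨x, hx⟩).2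
    · intro hy
      exact ⟨ε.symm ⟨y, hy⟩, (ε.symm ⟨y, hy⟩).2, by simp [hφ0]⟩
  have m1 : V₁.map (φ : V →ₗ[ℂ] V) = V₁ := by
    ext y
    constructor
    · rintro ⟨x, hx, rfl⟩
      simpa using (hφ1 ⟨x, hx⟩) ▸ (ζ ⟨x, hx⟩).2
    · intro hy
      exact ⟨ζ.symm ⟨y, hy⟩, (ζ.symm ⟨y, hy⟩).2, by simp [hφ1]⟩
  have hβ' : IsSupersymmetric V₀ V₁ (β.compl₁₂ (φ : V →ₗ[ℂ] V) (φ : V →ₗ[ℂ] V)) :=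
    hβ.of_equiv ⟨φ, m0, m1, fun u v => rfl⟩
  have heq : β.compl₁₂ (φ : V →ₗ[ℂ] V) (φ : V →ₗ[ℂ] V) = γ := by
    refine hβ'.ext_basis (e := e) (f := f) hγ ?_ ?_ ?_ hV <;> intro i j <;>
      simp [hφ0, hφ1, ε, ζ, h00, h01, h11]
  exact ⟨φ, m0, m1, fun u v => by rw [← heq]; rfl⟩

variable (hV : IsCompl V₀ V₁)

/-- The families need not be assumed to be bases: their Gram matrices are invertible and their sizes
equal the dimensions. -/
theorem formEquiv_gramForm_of_families (hm : Even m) {β : LinearMap.BilinForm ℂ V}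
    (hβ : IsSupersymmetric V₀ V₁ β) (e' : Fin k → V₀) (f' : Fin m → V₁)
    (B : Matrix (Fin k) (Fin m) ℂ)
    (h00 : ∀ i j, β (e' i) (e' j) = (1 : Matrix (Fin k) (Fin k) ℂ) i j)
    (h01 : ∀ i j, β (e' i) (f' j) = B i j)
    (h11 : ∀ i j, β (f' i) (f' j) = blockJ m i j) :
    FormEquiv V₀ V₁ β (gramForm hV e f B) := by
  have : FiniteDimensional ℂ V₀ := e.finiteDimensional_of_finite
  have : FiniteDimensional ℂ V₁ := f.finiteDimensional_of_finite
  have he : LinearIndependent ℂ e' :=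
    linearIndependent_of_gram (β.restrict V₀) e' 1 1 (one_mul 1) fun i j => h00 i j
  have hf : LinearIndependent ℂ f' :=
    linearIndependent_of_gram (β.restrict V₁) f' (blockJ m) (-blockJ m)
      (by rw [mul_neg, blockJ_mul_blockJ hm, neg_neg]) fun i j => h11 i j
  have ce : Fintype.card (Fin k) = finrank ℂ V₀ := (finrank_eq_card_basis e).symm
  have cf : Fintype.card (Fin m) = finrank ℂ V₁ := (finrank_eq_card_basis f).symm
  let E : Basis (Fin k) ℂ V₀ :=
    Basis.mk he (he.span_eq_top_of_card_eq_finrank' ce).ge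
  let F : Basis (Fin m) ℂ V₁ :=
    Basis.mk hf (hf.span_eq_top_of_card_eq_finrank' cf).ge
  exact formEquiv_of_bases e f hV E F hβ (isSupersymmetric_gramForm hV e f B)
    (by simp [E, h00]) (by simp [E, F, h01]) (by simp [F, h11])

theorem isPreOscillator_iff (β : LinearMap.BilinForm ℂ V) :
    IsPreOscillator V₀ V₁ β ↔ Even m ∧ ∃ B : Matrix (Fin k) (Fin m) ℂ, B ≠ 0 ∧
      FormEquiv V₀ V₁ β (gramForm hV e f B) := by
  have : FiniteDimensional ℂ V₀ := e.finiteDimensional_of_finite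
  have : FiniteDimensional ℂ V₁ := f.finiteDimensional_of_finite
  constructor
  · intro h
    have hs := h.supersymmetric
    obtain ⟨hm, f', hf'⟩ := exists_symplectic_family m (β.restrict V₁)
      (fun x y => hs.odd_odd _ x.2 _ y.2) h.nondegenerate_odd.1 (by simp [finrank_eq_card_basis f])
    obtain ⟨e', he'⟩ := exists_orthonormal_family (n := k) (β.restrict V₀)
      (fun x y => hs.even_even _ x.2 _ y.2) h.nondegenerate_even.1
      (by simp [finrank_eq_card_basis e])
    let B : Matrix (Fin k) (Fin m) ℂ := Matrix.of fun i j => β (e' i) (f' j)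
    have heq : FormEquiv V₀ V₁ β (gramForm hV e f B) :=
      formEquiv_gramForm_of_families e f hV hm hs e' f' B he' (fun i j => rfl) hf'
    refine ⟨hm, B, ?_, heq⟩
    intro hB
    obtain ⟨a, ha, b, hb, hab⟩ := (h.of_equiv heq).inhomogeneous.1
    exact hab <| bilin_eqOn_of_basis e f (gramForm hV e f B) 0 (fun i j => by simp [hB]) a ha b hb
  · rintro ⟨hm, B, hB, h⟩
    exact (isPreOscillator_gramForm hV e f B hm hB).of_equiv h.symm

theorem toMatrix_gram {k l : ℕ} {p q : Submodule ℂ V} (b : Basis (Fin k) ℂ p)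
    (c : Basis (Fin l) ℂ q) (φ : p →ₗ[ℂ] p) (ψ : q →ₗ[ℂ] q) (β : LinearMap.BilinForm ℂ V)
    (M : Matrix (Fin k) (Fin l) ℂ) (hM : ∀ i j, β (b i) (c j) = M i j) (i : Fin k) (j : Fin l) :
    β (φ (b i)) (ψ (c j)) =
      ((LinearMap.toMatrix b b φ)ᵀ * M * LinearMap.toMatrix c c ψ) i j := by
  have h1 : φ (b i) = ∑ r, LinearMap.toMatrix b b φ r i • b r := by
    simp [LinearMap.toMatrix_apply, b.sum_repr]
  have h2 : ψ (c j) = ∑ s, LinearMap.toMatrix c c ψ s j • c s := by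
    simp [LinearMap.toMatrix_apply, c.sum_repr]
  rw [h1, h2]
  simp only [Submodule.coe_sum, Submodule.coe_smul, map_sum, map_smul, LinearMap.sum_apply,
    LinearMap.smul_apply, smul_eq_mul, hM, Matrix.mul_apply, Matrix.transpose_apply,
    Finset.sum_mul, Finset.mul_sum]
  exact Finset.sum_congr rfl fun s _ => Finset.sum_congr rfl fun r _ => by ring

theorem formEquiv_gramForm_iff (hm : Even m) (B B' : Matrix (Fin k) (Fin m) ℂ) :
    FormEquiv V₀ V₁ (gramForm hV e f B) (gramForm hV e f B') ↔ SameOrbit B B' := by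
  constructor
  · rintro ⟨φ, h0, h1, h⟩
    let φ0 : V₀ →ₗ[ℂ] V₀ := (φ : V →ₗ[ℂ] V).restrict fun x hx => (mem_map_iff_of_map_eq h0 x).2 hx
    let φ1 : V₁ →ₗ[ℂ] V₁ := (φ : V →ₗ[ℂ] V).restrict fun x hx => (mem_map_iff_of_map_eq h1 x).2 hx
    have k1 : (LinearMap.toMatrix f f φ1)ᵀ * blockJ m * LinearMap.toMatrix f f φ1 = blockJ m := by
      ext i j
      rw [← toMatrix_gram f f φ1 φ1 (gramForm hV e f B) (blockJ m) (by simp)]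
      exact (h _ _).trans (by simp)
    refine ⟨LinearMap.toMatrix e e φ0, LinearMap.toMatrix f f φ1, ?_, ?_, k1, ?_⟩
    · ext i j
      rw [← mul_one (LinearMap.toMatrix e e φ0)ᵀ,
        ← toMatrix_gram e e φ0 φ0 (gramForm hV e f B) 1 (by simp)]
      exact (h _ _).trans (by simp)
    -- A symplectic Y has inverse -J Yᵀ J, because J² = -1.
    · refine IsUnit.of_mul_eq_one (-(blockJ m) * (LinearMap.toMatrix f f φ1)ᵀ * blockJ m) ?_
      rw [mul_eq_one_comm, mul_assoc, mul_assoc, ← mul_assoc _ (blockJ m), k1, neg_mul,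
        blockJ_mul_blockJ hm, neg_neg]
    · ext i j
      rw [← toMatrix_gram e f φ0 φ1 (gramForm hV e f B) B (by simp)]
      exact ((h _ _).trans (by simp)).symm
  · rintro ⟨X, Y, hX, hYu, hY, rfl⟩
    have g0 := toMatrix_gram e e (Matrix.toLin e e X) (Matrix.toLin e e X) (gramForm hV e f B) 1
      (by simp)
    have g1 := toMatrix_gram f f (Matrix.toLin f f Y) (Matrix.toLin f f Y) (gramForm hV e f B)
      (blockJ m) (by simp)
    have g2 := toMatrix_gram e f (Matrix.toLin e e X) (Matrix.toLin f f Y) (gramForm hV e f B) B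
      (by simp)
    simp only [LinearMap.toMatrix_toLin, hY, mul_one, hX] at g0 g1 g2
    exact formEquiv_gramForm_of_families e f hV hm (isSupersymmetric_gramForm hV e f B)
      (fun i => Matrix.toLin e e X (e i)) (fun i => Matrix.toLin f f Y (f i)) _ g0 g2 g1

end Recognition

/-! ### The odd operator and splitting of stable subspaces -/

section OddOperator

variable {V : Type*} [AddCommGroup V] [Module ℂ V] {V₀ V₁ : Submodule ℂ V}

theorem exists_homogeneous_parts (hV : IsCompl V₀ V₁) (v : V) :
    ∃ a ∈ V₀, ∃ b ∈ V₁, a + b = v :=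
  Submodule.mem_sup.1 (hV.sup_eq_top ▸ Submodule.mem_top)

theorem eq_zero_of_even_odd (hV : IsCompl V₀ V₁) {a b : V} (ha : a ∈ V₀) (hb : b ∈ V₁)
    (h : a + b = 0) : a = 0 ∧ b = 0 := by
  have hab : a = -b := eq_neg_of_add_eq_zero_left h
  have : a = 0 := Submodule.disjoint_def.1 hV.disjoint a ha (hab ▸ V₁.neg_mem hb)
  exact ⟨this, by simpa [this] using h⟩

theorem isSubsuperspace_of_even_part_mem (hV : IsCompl V₀ V₁) {U : Submodule ℂ V}
    (h : ∀ a ∈ V₀, ∀ b ∈ V₁, a + b ∈ U → a ∈ U) : IsSubsuperspace V₀ V₁ U := by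
  refine le_antisymm (fun u hu => ?_) (sup_le inf_le_left inf_le_left)
  obtain ⟨a, ha, b, hb, rfl⟩ := exists_homogeneous_parts hV u
  have haU := h a ha b hb hu
  exact Submodule.add_mem_sup ⟨haU, ha⟩ ⟨by simpa using U.sub_mem hu haU, hb⟩

/-- `h` is the even part and `(u, v) ↦ h (D u) v` the odd part of the form `β`. -/
structure IsOddOperator (V₀ V₁ : Submodule ℂ V) (β h : LinearMap.BilinForm ℂ V)
    (D : Module.End ℂ V) : Prop where
  even_odd : ∀ x ∈ V₀, ∀ y ∈ V₁, h x y = 0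
  odd_even : ∀ x ∈ V₁, ∀ y ∈ V₀, h x y = 0
  even_even : ∀ x ∈ V₀, ∀ y ∈ V₀, h x y = h y x
  odd_odd : ∀ x ∈ V₁, ∀ y ∈ V₁, h x y = -h y x
  nondeg : ∀ x, (∀ y, h x y = 0) → x = 0
  map_even : ∀ x ∈ V₀, D x ∈ V₁
  map_odd : ∀ x ∈ V₁, D x ∈ V₀
  adj_even : ∀ x ∈ V₀, ∀ y ∈ V₁, h (D x) y = h x (D y)
  apply_eq : ∀ x y, β x y = h x y + h (D x) y

theorem exists_isOddOperator [FiniteDimensional ℂ V] (hV : IsCompl V₀ V₁)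
    {β : LinearMap.BilinForm ℂ V} (hβ : IsSupersymmetric V₀ V₁ β)
    (n0 : (β.restrict V₀).Nondegenerate) (n1 : (β.restrict V₁).Nondegenerate) :
    ∃ h D, IsOddOperator V₀ V₁ β h D := by
  let p0 := V₀.projection V₁ hV
  let p1 := V₁.projection V₀ hV.symm
  have p00 : ∀ x ∈ V₀, p0 x = x := fun x hx => Submodule.projection_apply_of_mem_left hV hx
  have p11 : ∀ x ∈ V₁, p1 x = x := fun x hx => Submodule.projection_apply_of_mem_left hV.symm hx
  have p01 : ∀ x ∈ V₁, p0 x = 0 := fun x hx => (Submodule.projection_apply_eq_zero_iff hV).2 hx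
  have p10 : ∀ x ∈ V₀, p1 x = 0 := fun x hx => (Submodule.projection_apply_eq_zero_iff hV.symm).2 hx
  let h : LinearMap.BilinForm ℂ V := β.compl₁₂ p0 p0 + β.compl₁₂ p1 p1
  have h_apply : ∀ x y, h x y = β (p0 x) (p0 y) + β (p1 x) (p1 y) := fun x y => rfl
  have h00 : ∀ x ∈ V₀, ∀ y ∈ V₀, h x y = β x y := fun x hx y hy => by
    simp [h_apply, p00 x hx, p00 y hy, p10 x hx]
  have h11 : ∀ x ∈ V₁, ∀ y ∈ V₁, h x y = β x y := fun x hx y hy => by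
    simp [h_apply, p11 x hx, p11 y hy, p01 x hx]
  have h01 : ∀ x ∈ V₀, ∀ y ∈ V₁, h x y = 0 := fun x hx y hy => by
    simp [h_apply, p10 x hx, p01 y hy]
  have h10 : ∀ x ∈ V₁, ∀ y ∈ V₀, h x y = 0 := fun x hx y hy => by
    simp [h_apply, p01 x hx, p10 y hy]
  have nd0 : ∀ x ∈ V₀, (∀ y ∈ V₀, h x y = 0) → x = 0 := fun x hx hy =>
    congrArg Subtype.val <| n0.1 ⟨x, hx⟩ fun y => (h00 x hx y y.2).symm.trans (hy y y.2)
  have nd1 : ∀ x ∈ V₁, (∀ y ∈ V₁, h x y = 0) → x = 0 := fun x hx hy =>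
    congrArg Subtype.val <| n1.1 ⟨x, hx⟩ fun y => (h11 x hx y y.2).symm.trans (hy y y.2)
  have nd : ∀ x, (∀ y, h x y = 0) → x = 0 := by
    intro x hx
    obtain ⟨a, ha, b, hb, rfl⟩ := exists_homogeneous_parts hV x
    rw [nd0 a ha fun y hy => by simpa [h10 b hb y hy] using hx y,
      nd1 b hb fun y hy => by simpa [h01 a ha y hy] using hx y, add_zero]
  have nd' : h.Nondegenerate := LinearMap.BilinForm.Nondegenerate.ofSeparatingLeft nd
  -- D represents the mixed part β - h through the nondegenerate h. It is odd because β - h vanishes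
  -- on `V₀ × V₀` and on `V₁ × V₁`.
  let D : Module.End ℂ V := (β - h).symmCompOfNondegenerate h nd'
  have hD : ∀ x y, h (D x) y = β x y - h x y := fun x y =>
    LinearMap.BilinForm.symmCompOfNondegenerate_left_apply (β - h) nd' y x
  have mp0 : ∀ x ∈ V₀, D x ∈ V₁ := by
    intro x hx
    obtain ⟨a, ha, b, hb, hab⟩ := exists_homogeneous_parts hV (D x)
    have : a = 0 := nd0 a ha fun y hy => by
      have := hD x y
      rw [← hab, h00 x hx y hy, sub_self, map_add, LinearMap.add_apply, h10 b hb y hy] at this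
      simpa using this
    rw [← hab, this, zero_add]
    exact hb
  have mp1 : ∀ x ∈ V₁, D x ∈ V₀ := by
    intro x hx
    obtain ⟨a, ha, b, hb, hab⟩ := exists_homogeneous_parts hV (D x)
    have : b = 0 := nd1 b hb fun y hy => by
      have := hD x y
      rw [← hab, h11 x hx y hy, sub_self, map_add, LinearMap.add_apply, h01 a ha y hy] at this
      simpa using this
    rw [← hab, this, add_zero]
    exact ha
  have sy : ∀ x ∈ V₀, ∀ y ∈ V₀, h x y = h y x := fun x hx y hy => by
    rw [h00 x hx y hy, h00 y hy x hx, hβ.even_even x hx y hy]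
  refine ⟨h, D, h01, h10, sy, fun x hx y hy => ?_, nd, mp0, mp1, fun x hx y hy => ?_,
    fun x y => by rw [hD]; ring⟩
  · rw [h11 x hx y hy, h11 y hy x hx, hβ.odd_odd x hx y hy]
  · rw [sy x hx _ (mp1 y hy), hD, hD, h01 x hx y hy, h10 y hy x hx, hβ.even_odd x hx y hy]

namespace IsOddOperator

variable {β h : LinearMap.BilinForm ℂ V} {D : Module.End ℂ V}
  (hD : IsOddOperator V₀ V₁ β h D) (hV : IsCompl V₀ V₁)

include hD in
theorem adj_odd {x y : V} (hx : x ∈ V₁) (hy : y ∈ V₀) : h (D x) y = -h x (D y) := by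
  rw [hD.even_even _ (hD.map_odd x hx) y hy, ← hD.adj_even y hy x hx,
    hD.odd_odd _ (hD.map_even y hy) x hx]

include hD hV in
-- Of the two moves of D across h, exactly one starts from an odd vector and costs a sign.
theorem sq_skew (x y : V) : h (D (D x)) y = -h x (D (D y)) := by
  obtain ⟨a, ha, b, hb, rfl⟩ := exists_homogeneous_parts hV x
  obtain ⟨c, hc, d, hd, rfl⟩ := exists_homogeneous_parts hV y
  have ha1 := hD.map_even a ha
  have ha2 := hD.map_odd _ ha1
  have hb1 := hD.map_odd b hb
  have hb2 := hD.map_even _ hb1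
  have hc1 := hD.map_even c hc
  have hc2 := hD.map_odd _ hc1
  have hd1 := hD.map_odd d hd
  have hd2 := hD.map_even _ hd1
  simp only [map_add, LinearMap.add_apply, hD.even_odd _ ha2 d hd, hD.odd_even _ hb2 c hc,
    hD.even_odd a ha _ hd2, hD.odd_even b hb _ hc2, hD.adj_odd ha1 hc, hD.adj_even a ha _ hc1,
    hD.adj_even _ hb1 d hd, hD.adj_odd hb hd1]
  ring

include hD hV in
theorem sq_pow_skew (n : ℕ) :
    ∀ x y : V, h (((D ^ 2) ^ n) x) y = (-1) ^ n * h x (((D ^ 2) ^ n) y) := by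
  induction n with
  | zero => simp
  | succ n ih =>
    intro x y
    have hs := hD.sq_skew hV
    rw [pow_succ, Module.End.mul_apply, ih, pow_two D, Module.End.mul_apply, hs,
      ← Module.End.mul_apply D D, ← pow_two, ← Module.End.mul_apply, ← pow_succ', ← pow_succ]
    ring

include hD in
theorem sq_pow_map_even (n : ℕ) {x : V} (hx : x ∈ V₀) : ((D ^ 2) ^ n) x ∈ V₀ := by
  induction n with
  | zero => simpa
  | succ n ih =>
    rw [pow_succ', Module.End.mul_apply, pow_two]
    exact hD.map_odd _ (hD.map_even _ ih)

include hD in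
theorem sq_pow_map_odd (n : ℕ) {x : V} (hx : x ∈ V₁) : ((D ^ 2) ^ n) x ∈ V₁ := by
  induction n with
  | zero => simpa
  | succ n ih =>
    rw [pow_succ', Module.End.mul_apply, pow_two]
    exact hD.map_even _ (hD.map_odd _ ih)

include hD in
theorem isReducible_of_isCompl {U W : Submodule ℂ V} (hU : IsSubsuperspace V₀ V₁ U)
    (hW : IsSubsuperspace V₀ V₁ W) (hUW : IsCompl U W) (hU0 : U ≠ ⊥) (hW0 : W ≠ ⊥)
    (hDU : ∀ u ∈ U, D u ∈ U) (ho : ∀ u ∈ U, ∀ w ∈ W, h u w = 0) : IsReducible V₀ V₁ β :=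
  ⟨U, W, hU, hW, hU0, hW0, hUW, fun u hu w hw => by
    rw [hD.apply_eq, ho u hu w hw, ho _ (hDU u hu) w hw, add_zero]⟩

include hD hV in
/-- The odd operator of an irreducible form is nilpotent or injective (Fitting). -/
theorem isNilpotent_or_injective [FiniteDimensional ℂ V] (hirr : IsIrreducible V₀ V₁ β) :
    IsNilpotent D ∨ Function.Injective D := by
  obtain ⟨N, hN⟩ := Filter.eventually_atTop.1 D.eventually_isCompl_ker_pow_range_pow
  -- An even exponent makes kernel and range homogeneous, and makes the power its own h-adjoint up
  -- to sign, so that they are h-orthogonal. Taking N + 1 keeps the exponent positive, so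
  -- injectivity of the power yields that of D.
  have hc := hN (2 * (N + 1)) (by omega)
  rw [pow_mul] at hc
  by_contra! hcon
  refine hirr (hD.isReducible_of_isCompl ?_ ?_ hc ?_ ?_ ?_ ?_)
  · refine isSubsuperspace_of_even_part_mem hV fun a ha b hb hab => ?_
    rw [LinearMap.mem_ker, map_add] at hab
    exact (eq_zero_of_even_odd hV (hD.sq_pow_map_even _ ha) (hD.sq_pow_map_odd _ hb) hab).1
  · refine isSubsuperspace_of_even_part_mem hV fun a ha b hb ⟨v, hv⟩ => ?_
    obtain ⟨c, hc, d, hd, rfl⟩ := exists_homogeneous_parts hV v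
    rw [map_add] at hv
    have h1 := hD.sq_pow_map_even (N + 1) hc
    have h2 := hD.sq_pow_map_odd (N + 1) hd
    have h3 := (eq_zero_of_even_odd hV (V₀.sub_mem h1 ha) (V₁.sub_mem h2 hb)
      (by rw [sub_add_sub_comm, hv, sub_self])).1
    exact ⟨c, sub_eq_zero.1 h3⟩
  · intro hbot
    refine hcon.2 ?_
    rw [← pow_mul, LinearMap.ker_eq_bot] at hbot
    have : ⇑(D ^ (2 * (N + 1))) = ⇑(D ^ (2 * N + 1)) ∘ ⇑D := by
      rw [← Module.End.coe_mul, ← pow_succ]; rfl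
    rw [this] at hbot
    exact hbot.of_comp
  · intro hbot
    exact hcon.1 ⟨2 * (N + 1), by rw [pow_mul]; exact LinearMap.range_eq_bot.1 hbot⟩
  · intro u hu
    rw [← pow_mul, LinearMap.mem_ker] at hu ⊢
    rw [← Module.End.mul_apply, ← pow_succ, pow_succ', Module.End.mul_apply, hu, map_zero]
  · rintro u hu _ ⟨v, rfl⟩
    have := hD.sq_pow_skew hV (N + 1) u v
    rw [LinearMap.mem_ker.1 hu] at this
    simpa using this.symm

include hD hV in
-- The h-orthogonal of `U` is homogeneous, meets `U` trivially, and has codimension at most dim U as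
-- the kernel of a map to the dual of `U`. It is thus a β-orthogonal complement, and irreducibility
-- makes it zero.
theorem eq_top_of_nondegenerate [FiniteDimensional ℂ V] (hirr : IsIrreducible V₀ V₁ β)
    {U : Submodule ℂ V} (hU : IsSubsuperspace V₀ V₁ U) (hU0 : U ≠ ⊥)
    (hDU : ∀ u ∈ U, D u ∈ U) (hnd : ∀ u ∈ U, (∀ v ∈ U, h v u = 0) → u = 0) : U = ⊤ := by
  let L : V →ₗ[ℂ] Module.Dual ℂ U := U.dualRestrict ∘ₗ h.flip
  have hL : ∀ v, v ∈ LinearMap.ker L ↔ ∀ u ∈ U, h u v = 0 := by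
    intro v
    rw [LinearMap.mem_ker, LinearMap.ext_iff]
    exact ⟨fun H u hu => H ⟨u, hu⟩, fun H u => H u u.2⟩
  have hdisj : Disjoint U (LinearMap.ker L) := Submodule.disjoint_def.2 fun u hu hu' =>
    hnd u hu ((hL u).1 hu')
  have hsup : U ⊔ LinearMap.ker L = ⊤ := by
    refine Submodule.eq_top_of_finrank_eq (le_antisymm (Submodule.finrank_le _) ?_)
    have h1 := Submodule.finrank_sup_add_finrank_inf_eq U (LinearMap.ker L)
    rw [hdisj.eq_bot, finrank_bot] at h1
    have h2 := L.finrank_range_add_finrank_ker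
    have h3 := (LinearMap.range L).finrank_le
    rw [Subspace.dual_finrank_eq] at h3
    omega
  by_contra htop
  have hpart : ∀ u ∈ U, ∃ a ∈ U ⊓ V₀, ∃ b ∈ U ⊓ V₁, a + b = u := fun u hu =>
    Submodule.mem_sup.1 (hU ▸ hu)
  refine hirr (hD.isReducible_of_isCompl hU ?_ ⟨hdisj, codisjoint_iff.2 hsup⟩ hU0 ?_ hDU
    fun u hu w hw => (hL w).1 hw u hu)
  · refine isSubsuperspace_of_even_part_mem hV fun a ha b hb hab => (hL a).2 fun u hu => ?_
    obtain ⟨c, hc, d, hd, rfl⟩ := hpart u hu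
    have := (hL _).1 hab c hc.1
    rw [map_add, hD.even_odd c hc.2 b hb, add_zero] at this
    rw [map_add, LinearMap.add_apply, this, hD.odd_even d hd.2 a ha, add_zero]
  · rintro hbot
    rw [hbot, sup_bot_eq] at hsup
    exact htop hsup

include hD hV in
/-- Recognition of a listed form from an adapted family of vectors. -/
theorem exists_isListed_of_families [FiniteDimensional ℂ V] (hirr : IsIrreducible V₀ V₁ β)
    (hs : IsSupersymmetric V₀ V₁ β)
    {k m : ℕ} (e : Basis (Fin k) ℂ V₀) (f : Basis (Fin m) ℂ V₁)
    {k' m' : ℕ} (hm' : Even m') (hpos : 0 < k') (e' : Fin k' → V) (f' : Fin m' → V)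
    (he' : ∀ i, e' i ∈ V₀) (hf' : ∀ i, f' i ∈ V₁)
    (hee : ∀ i j, h (e' i) (e' j) = (1 : Matrix (Fin k') (Fin k') ℂ) i j)
    (hff : ∀ i j, h (f' i) (f' j) = blockJ m' i j)
    (B : Matrix (Fin k') (Fin m') ℂ) (C : Matrix (Fin k') (Fin m') ℂ)
    (hDf : ∀ j, D (f' j) = ∑ i, B i j • e' i) (hDe : ∀ i, D (e' i) = ∑ j, C i j • f' j)
    (hB : IsListed k' m' B) :
    ∃ B : Matrix (Fin k) (Fin m) ℂ, IsListed k m B ∧ FormEquiv V₀ V₁ β (gramForm hV e f B) := by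
  have le : LinearIndependent ℂ e' := linearIndependent_of_gram h e' 1 1 (one_mul 1) hee
  have lf : LinearIndependent ℂ f' := linearIndependent_of_gram h f' (blockJ m') (-blockJ m')
      (by rw [mul_neg, blockJ_mul_blockJ hm', neg_neg]) hff
  let S := Submodule.span ℂ (Set.range e')
  let T := Submodule.span ℂ (Set.range f')
  have hS : S ≤ V₀ := Submodule.span_le.2 (Set.range_subset_iff.2 he')
  have hT : T ≤ V₁ := Submodule.span_le.2 (Set.range_subset_iff.2 hf')
  have heS : ∀ i, e' i ∈ S := fun i => Submodule.subset_span ⟨i, rfl⟩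
  have hfT : ∀ i, f' i ∈ T := fun i => Submodule.subset_span ⟨i, rfl⟩
  have hDS : ∀ x ∈ S, D x ∈ T := by
    change S ≤ T.comap D
    refine Submodule.span_le.2 (Set.range_subset_iff.2 fun i => ?_)
    change D (e' i) ∈ T
    -- `C` serves only to make the span stable under D; the form itself is fixed by `B`.
    rw [hDe]
    exact T.sum_mem fun j _ => T.smul_mem _ (hfT j)
  have hDT : ∀ x ∈ T, D x ∈ S := by
    change T ≤ S.comap D
    refine Submodule.span_le.2 (Set.range_subset_iff.2 fun i => ?_)
    change D (f' i) ∈ S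
    rw [hDf]
    exact S.sum_mem fun j _ => S.smul_mem _ (heS j)
  have hdisj : ∀ {a b : V}, a ∈ V₀ → b ∈ V₁ → a + b ∈ S ⊔ T → a ∈ S ∧ b ∈ T := by
    intro a b ha hb hab
    obtain ⟨s, hs, t, ht, hst⟩ := Submodule.mem_sup.1 hab
    have := eq_zero_of_even_odd hV (V₀.sub_mem (hS hs) ha) (V₁.sub_mem (hT ht) hb)
      (by rw [sub_add_sub_comm, hst, sub_self])
    exact ⟨sub_eq_zero.1 this.1 ▸ hs, sub_eq_zero.1 this.2 ▸ ht⟩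
  have htop : S ⊔ T = ⊤ := by
    refine hD.eq_top_of_nondegenerate hV hirr ?_ ?_ ?_ ?_
    · exact isSubsuperspace_of_even_part_mem hV fun a ha b hb hab =>
        Submodule.mem_sup_left (hdisj ha hb hab).1
    · intro hbot
      have : e' ⟨0, hpos⟩ ∈ S ⊔ T := Submodule.mem_sup_left (heS _)
      rw [hbot, Submodule.mem_bot] at this
      exact le.ne_zero _ this
    · intro u hu
      obtain ⟨s, hs, t, ht, rfl⟩ := Submodule.mem_sup.1 hu
      rw [map_add, add_comm]
      exact Submodule.add_mem_sup (hDT t ht) (hDS s hs)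
    · intro u hu H
      obtain ⟨s, hs, t, ht, rfl⟩ := Submodule.mem_sup.1 hu
      have hs0 : ∀ i, h (e' i) s = 0 := fun i => by
        simpa [hD.even_odd _ (he' i) t (hT ht)] using H _ (Submodule.mem_sup_left (heS i))
      have ht0 : ∀ i, h (f' i) t = 0 := fun i => by
        simpa [hD.odd_even _ (hf' i) s (hS hs)] using H _ (Submodule.mem_sup_right (hfT i))
      obtain ⟨a, rfl⟩ := (Submodule.mem_span_range_iff_exists_fun ℂ).1 hs
      obtain ⟨b, rfl⟩ := (Submodule.mem_span_range_iff_exists_fun ℂ).1 ht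
      have ha : a = 0 := by
        ext i
        simpa [hee, Matrix.one_apply] using hs0 i
      have hb : b = 0 := by
        have : blockJ m' *ᵥ b = 0 := by
          ext i
          simpa [hff, Matrix.mulVec, dotProduct, mul_comm] using ht0 i
        have h2 : (blockJ m' * blockJ m') *ᵥ b = 0 := by
          rw [← Matrix.mulVec_mulVec, this, Matrix.mulVec_zero]
        rw [blockJ_mul_blockJ hm', Matrix.neg_mulVec, Matrix.one_mulVec] at h2
        exact neg_eq_zero.1 h2
      simp [ha, hb]
  -- Since the span is all of V, its even and odd parts are `V₀` and `V₁`, which forces the sizes to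
  -- agree.
  have hSV : S = V₀ := le_antisymm hS fun x hx =>
    (hdisj hx V₁.zero_mem (htop ▸ Submodule.mem_top)).1
  have hTV : T = V₁ := le_antisymm hT fun x hx =>
    (hdisj V₀.zero_mem hx (htop ▸ Submodule.mem_top)).2
  obtain rfl : k = k' := by
    have h1 := finrank_span_eq_card le
    change finrank ℂ S = _ at h1
    rw [hSV, finrank_eq_card_basis e] at h1
    simpa using h1
  obtain rfl : m = m' := by
    have h1 := finrank_span_eq_card lf
    change finrank ℂ T = _ at h1
    rw [hTV, finrank_eq_card_basis f] at h1
    simpa using h1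
  refine ⟨B, hB, formEquiv_gramForm_of_families e f hV hm' hs (fun i => ⟨e' i, he' i⟩)
    (fun i => ⟨f' i, hf' i⟩) B (fun i j => ?_) (fun i j => ?_) (fun i j => ?_)⟩
  · rw [hD.apply_eq, hee, hD.odd_even _ (hD.map_even _ (he' i)) _ (he' j), add_zero]
  · rw [hD.apply_eq, hD.even_odd _ (he' i) _ (hf' j), zero_add, hD.adj_even _ (he' i) _ (hf' j),
      hDf]
    simp [hee, Matrix.one_apply]
  · rw [hD.apply_eq, hff, hD.even_odd _ (hD.map_odd _ (hf' i)) _ (hf' j), add_zero]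

end IsOddOperator

end OddOperator

/-! ### Adapted bases from normalised Jordan chains -/

section NormalForms

variable {V : Type*} [AddCommGroup V] [Module ℂ V] {V₀ V₁ : Submodule ℂ V}

theorem forall_fin_three {P : Fin 3 → Prop} : (∀ i, P i) ↔ P 0 ∧ P 1 ∧ P 2 := by
  simp [Fin.forall_fin_succ]

theorem forall_fin_four {P : Fin 4 → Prop} : (∀ i, P i) ↔ P 0 ∧ P 1 ∧ P 2 ∧ P 3 := by
  simp [Fin.forall_fin_succ]

namespace IsOddOperator

variable {β h : LinearMap.BilinForm ℂ V} {D : Module.End ℂ V}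
  (hD : IsOddOperator V₀ V₁ β h D) (hV : IsCompl V₀ V₁)

include hD hV

theorem apply_map_of_even {x : V} (hx : x ∈ V₀) (v : V) : h (D x) v = h x (D v) := by
  obtain ⟨a, ha, b, hb, rfl⟩ := exists_homogeneous_parts hV v
  simp [hD.adj_even x hx b hb, hD.odd_even _ (hD.map_even x hx) a ha,
    hD.even_odd x hx _ (hD.map_even a ha)]

theorem apply_map_of_odd {x : V} (hx : x ∈ V₁) (v : V) : h (D x) v = -h x (D v) := by
  obtain ⟨a, ha, b, hb, rfl⟩ := exists_homogeneous_parts hV v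
  simp [hD.adj_odd hx ha, hD.even_odd _ (hD.map_odd x hx) b hb,
    hD.odd_even x hx _ (hD.map_odd b hb)]

variable [FiniteDimensional ℂ V] (hirr : IsIrreducible V₀ V₁ β)
    (hs : IsSupersymmetric V₀ V₁ β)
    {k m : ℕ} (e : Basis (Fin k) ℂ V₀) (f : Basis (Fin m) ℂ V₁)

include hirr hs

theorem exists_isListed_one_two {y : V} (hy : y ∈ V₁) (h3 : D (D (D y)) = 0)
    (h2 : h y (D (D y)) = -1) :
    ∃ B : Matrix (Fin k) (Fin m) ℂ, IsListed k m B ∧ FormEquiv V₀ V₁ β (gramForm hV e f B) := by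
  have m1 := hD.map_odd _ hy
  have m2 := hD.map_even _ m1
  have a0 := hD.apply_map_of_odd hV hy
  have a1 := hD.apply_map_of_even hV m1
  have h0 : h y y = 0 := self_eq_neg.mp (hD.odd_odd y hy y hy)
  -- Throughout, column j of `B` holds the coordinates of D (f j), and C = -B J then gives D on the
  -- even vectors.
  refine hD.exists_isListed_of_families hV hirr hs e f even_two one_pos ![D y] ![y, -D (D y)]
    ?_ ?_ ?_ ?_ _ !![0, -1] ?_ ?_ IsListed.B₁
  · simpa using m1
  · simpa [Fin.forall_fin_two] using ⟨hy, m2⟩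
  · simp [a0, h2]
  · simp [Fin.forall_fin_two, blockJ, a0, a1, h0, h2, h3]
  · simp [Fin.forall_fin_two, h3]
  · simp [Fin.sum_univ_two]

theorem exists_isListed_three_two {x : V} (hx : x ∈ V₀) (h5 : D (D (D (D (D x)))) = 0)
    (h0 : h x x = 0) (h4 : h x (D (D (D (D x)))) = -1) :
    ∃ B : Matrix (Fin k) (Fin m) ℂ, IsListed k m B ∧ FormEquiv V₀ V₁ β (gramForm hV e f B) := by
  have m1 := hD.map_even _ hx
  have m2 := hD.map_odd _ m1
  have m3 := hD.map_even _ m2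
  have m4 := hD.map_odd _ m3
  have a0 := hD.apply_map_of_even hV hx
  have a1 := hD.apply_map_of_odd hV m1
  have a2 := hD.apply_map_of_even hV m2
  have a3 := hD.apply_map_of_odd hV m3
  have h2 : h x (D (D x)) = 0 := by
    have := hD.even_even x hx _ m2
    rw [a1, a0] at this
    exact self_eq_neg.mp this
  -- The isotropic vectors x and D⁴x pair to -1; the last two even vectors orthonormalise their
  -- plane, with D (f 1) = -D⁴x = e 1 + i e 2.
  refine hD.exists_isListed_of_families hV hirr hs e f even_two three_pos
    ![D (D x), x - (1 / 2 : ℂ) • D (D (D (D x))),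
      Complex.I • x + (Complex.I / 2) • D (D (D (D x)))] ![D x, -D (D (D x))]
    ?_ ?_ ?_ ?_ _ !![0, -1; 1, 0; Complex.I, 0] ?_ ?_ IsListed.B₄
  · simpa [Fin.forall_fin_two, forall_fin_three] using ⟨m2, V₀.sub_mem hx (V₀.smul_mem _ m4),
      V₀.add_mem (V₀.smul_mem _ hx) (V₀.smul_mem _ m4)⟩
  · simpa [Fin.forall_fin_two, forall_fin_three] using ⟨m1, m3⟩
  · simp [forall_fin_three, a0, a1, a2, a3, h0, h2, h4, h5]
    ring_nf
    simp
  · simp [Fin.forall_fin_two, blockJ, a0, a1, a2, h2, h4, h5]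
  · simp [Fin.forall_fin_two, Fin.sum_univ_three]
    match_scalars <;> ring_nf <;> simp only [Complex.I_sq] <;> norm_num
  · simp [forall_fin_three, Fin.sum_univ_two, h5]

theorem exists_isListed_three_four {y : V} (hy : y ∈ V₁)
    (h7 : D (D (D (D (D (D (D y)))))) = 0)
    (h2 : h y (D (D y)) = -1) (h6 : h y (D (D (D (D (D (D y)))))) = 1) :
    ∃ B : Matrix (Fin k) (Fin m) ℂ, IsListed k m B ∧ FormEquiv V₀ V₁ β (gramForm hV e f B) := by
  have m1 := hD.map_odd _ hy
  have m2 := hD.map_even _ m1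
  have m3 := hD.map_odd _ m2
  have m4 := hD.map_even _ m3
  have m5 := hD.map_odd _ m4
  have m6 := hD.map_even _ m5
  have a0 := hD.apply_map_of_odd hV hy
  have a1 := hD.apply_map_of_even hV m1
  have a2 := hD.apply_map_of_odd hV m2
  have a3 := hD.apply_map_of_even hV m3
  have a4 := hD.apply_map_of_odd hV m4
  have a5 := hD.apply_map_of_even hV m5
  have h0 : h y y = 0 := self_eq_neg.mp (hD.odd_odd y hy y hy)
  have h4 : h y (D (D (D (D y)))) = 0 := by
    have := hD.odd_odd y hy _ m4
    rw [a3, a2, a1, a0, neg_neg] at this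
    exact self_eq_neg.mp this
  -- A single chain of length 7. The sums mix degrees 1 and 5, 2 and 6, 0 and 4 so that the two
  -- symplectic planes become orthogonal.
  refine hD.exists_isListed_of_families hV hirr hs e f (by decide) three_pos
    ![D y, -D (D (D y)), -(Complex.I • (D (D (D (D (D y)))) + D y))]
    ![y, -D (D y), -D (D y) - D (D (D (D (D (D y))))), D (D (D (D y))) + y]
    ?_ ?_ ?_ ?_ _ !![0, -1, 0, 0; 1, 0, 0, -1; 0, 0, Complex.I, 0] ?_ ?_ IsListed.B₅
  · simpa [Fin.forall_fin_two, forall_fin_three, forall_fin_four] using ⟨m1, m3,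
      V₀.add_mem (V₀.neg_mem (V₀.smul_mem _ m1)) (V₀.neg_mem (V₀.smul_mem _ m5))⟩
  · simpa [Fin.forall_fin_two, forall_fin_three, forall_fin_four] using
      ⟨hy, m2, V₁.sub_mem (V₁.neg_mem m2) m6, V₁.add_mem m4 hy⟩
  · simp [forall_fin_three, a0, a1, a2, a3, a4, h2, h4, h6, h7]
  · simp [forall_fin_four, blockJ, a0, a1, a2, a3, a4, a5, h0, h2, h4, h6, h7]
  · simp [forall_fin_four, Fin.sum_univ_three, smul_smul, h7]
    exact add_comm _ _
  · simp [forall_fin_three, Fin.sum_univ_four]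
    module

theorem exists_isListed_two_two {x y : V} (hx : x ∈ V₀) (hy : y ∈ V₁) (hx2 : D (D x) = 0)
    (hy2 : D (D y) = 0) (h0 : h x x = 0) (h1 : h x (D y) = 1) :
    ∃ B : Matrix (Fin k) (Fin m) ℂ, IsListed k m B ∧ FormEquiv V₀ V₁ β (gramForm hV e f B) := by
  have mx1 := hD.map_even _ hx
  have my1 := hD.map_odd _ hy
  have ax := hD.apply_map_of_even hV hx
  have ay := hD.apply_map_of_odd hV hy
  have hyy : h y y = 0 := self_eq_neg.mp (hD.odd_odd y hy y hy)
  have h1' : h y (D x) = -1 := by rw [hD.odd_odd y hy _ mx1, ax, h1]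
  refine hD.exists_isListed_of_families hV hirr hs e f even_two two_pos
    ![x + (1 / 2 : ℂ) • D y, Complex.I • x - (Complex.I / 2) • D y] ![y, -D x]
    ?_ ?_ ?_ ?_ _ !![0, -1; 0, -Complex.I] ?_ ?_ IsListed.B₃
  · simpa [Fin.forall_fin_two] using ⟨V₀.add_mem hx (V₀.smul_mem _ my1),
      V₀.sub_mem (V₀.smul_mem _ hx) (V₀.smul_mem _ my1)⟩
  · simpa [Fin.forall_fin_two] using ⟨hy, mx1⟩
  · simp [Fin.forall_fin_two, ay, h0, h1, h1', hy2]
    ring_nf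
    simp
  · simp [Fin.forall_fin_two, blockJ, ax, h1', hyy, h1, hx2]
  · simp [Fin.forall_fin_two, Fin.sum_univ_two, hx2]
    match_scalars <;> ring_nf <;> simp only [Complex.I_sq] <;> norm_num
  · simp [Fin.forall_fin_two, Fin.sum_univ_two, hy2]

theorem exists_isListed_four_two {x y : V} (hx : x ∈ V₀) (hy : y ∈ V₀)
    (hx3 : D (D (D x)) = 0) (hy3 : D (D (D y)) = 0) (hxx : h x x = 0) (hyy : h y y = 0)
    (hxy : h x y = 0) (h2 : h x (D (D y)) = 1) :
    ∃ B : Matrix (Fin k) (Fin m) ℂ, IsListed k m B ∧ FormEquiv V₀ V₁ β (gramForm hV e f B) := by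
  have mx1 := hD.map_even _ hx
  have my1 := hD.map_even _ hy
  have mx2 := hD.map_odd _ mx1
  have my2 := hD.map_odd _ my1
  have ax := hD.apply_map_of_even hV hx
  have ay := hD.apply_map_of_even hV hy
  have ax1 := hD.apply_map_of_odd hV mx1
  have ay1 := hD.apply_map_of_odd hV my1
  have hyx : h y x = 0 := by rw [hD.even_even y hy x hx, hxy]
  have h2' : h y (D (D x)) = -1 := by rw [hD.even_even y hy _ mx2, ax1, ax, h2]
  have hx2 : h x (D (D x)) = 0 := by
    have := hD.even_even x hx _ mx2
    rw [ax1, ax] at this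
    exact self_eq_neg.mp this
  have hy2 : h y (D (D y)) = 0 := by
    have := hD.even_even y hy _ my2
    rw [ay1, ay] at this
    exact self_eq_neg.mp this
  -- Two chains of length 3; the hyperbolic pairs (x, D²y) and (y, -D²x) are each orthonormalised.
  refine hD.exists_isListed_of_families hV hirr hs e f even_two four_pos
    ![x + (1 / 2 : ℂ) • D (D y), Complex.I • x - (Complex.I / 2) • D (D y),
      y - (1 / 2 : ℂ) • D (D x), Complex.I • y + (Complex.I / 2) • D (D x)] ![D y, -D x]
    ?_ ?_ ?_ ?_ _ !![0, -1; 0, -Complex.I; 1, 0; Complex.I, 0] ?_ ?_ IsListed.B₆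
  · simpa [Fin.forall_fin_two, forall_fin_four] using ⟨V₀.add_mem hx (V₀.smul_mem _ my2),
      V₀.sub_mem (V₀.smul_mem _ hx) (V₀.smul_mem _ my2), V₀.sub_mem hy (V₀.smul_mem _ mx2),
      V₀.add_mem (V₀.smul_mem _ hy) (V₀.smul_mem _ mx2)⟩
  · simpa [Fin.forall_fin_two, forall_fin_four] using ⟨my1, mx1⟩
  · simp [forall_fin_four, ax, ay, ax1, ay1, hxx, hyy, hxy, hyx, h2, h2', hx2, hy2, hx3, hy3]
    ring_nf
    simp
  · simp [Fin.forall_fin_two, blockJ, ax, ay, hx2, hy2, h2, h2']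
  · simp [Fin.forall_fin_two, Fin.sum_univ_four]
    constructor <;> match_scalars <;> ring_nf <;> simp only [Complex.I_sq] <;> norm_num
  · simp [forall_fin_four, Fin.sum_univ_two, hx3, hy3]

end IsOddOperator

end NormalForms

/-! ### Classification when the odd operator is nilpotent -/

section Nilpotent

variable {V : Type*} [AddCommGroup V] [Module ℂ V] {V₀ V₁ : Submodule ℂ V}

/-- The rank of D^n counts the Jordan blocks of size n + 1. Without Jordan form: for l < n the range
of D^n lies in ker D ∩ range D^l, so each step from D^l to D^(l+1) loses at least that rank. -/
theorem finrank_range_pow_mul_le [FiniteDimensional ℂ V] (D : Module.End ℂ V) (n : ℕ)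
    (hn : D ^ (n + 1) = 0) : finrank ℂ (LinearMap.range (D ^ n)) * (n + 1) ≤ finrank ℂ V := by
  suffices H : ∀ i ≤ n, finrank ℂ (LinearMap.range (D ^ n)) * (i + 1) ≤
      finrank ℂ (LinearMap.range (D ^ (n - i))) from
    (H n le_rfl).trans (Submodule.finrank_le _)
  intro i
  induction i with
  | zero => simp
  | succ i ih =>
    intro hi
    have h1 := ih (by omega)
    obtain ⟨l, rfl⟩ : ∃ l, n = l + (i + 1) := ⟨n - (i + 1), by omega⟩
    rw [show l + (i + 1) - i = l + 1 by omega] at h1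
    rw [show l + (i + 1) - (i + 1) = l by omega]
    have h2 := (D.domRestrict (LinearMap.range (D ^ l))).finrank_range_add_finrank_ker
    rw [LinearMap.range_domRestrict, ← LinearMap.range_comp, ← Module.End.mul_eq_comp,
      ← pow_succ'] at h2
    have h3 : LinearMap.range (D ^ (l + (i + 1))) ≤
        (LinearMap.ker (D.domRestrict (LinearMap.range (D ^ l)))).map (Submodule.subtype _) := by
      rintro _ ⟨v, rfl⟩
      refine ⟨⟨(D ^ (l + (i + 1))) v, ⟨(D ^ (i + 1)) v, ?_⟩⟩, ?_, rfl⟩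
      · exact (LinearMap.congr_fun (pow_add D l (i + 1)) v).symm
      · change D ((D ^ (l + (i + 1))) v) = 0
        rw [← Module.End.mul_apply, ← pow_succ', hn, LinearMap.zero_apply]
    have h4 := (Submodule.finrank_mono h3).trans (Submodule.finrank_map_le _ _)
    rw [mul_add, mul_one]
    omega

theorem exists_sq_mul_eq (t c : ℂ) (ht : t ≠ 0) : ∃ s : ℂ, s * (s * t) = c := by
  obtain ⟨s, hs⟩ := IsAlgClosed.exists_pow_nat_eq (c / t) (n := 2) two_pos
  exact ⟨s, by rw [← mul_assoc, ← sq, hs, div_mul_cancel₀ _ ht]⟩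

/-- Polarisation: a nonzero symmetric pairing has a non-isotropic vector, which will head a Jordan
chain. -/
theorem exists_apply_self_ne_zero {W : Submodule ℂ V} {h : LinearMap.BilinForm ℂ V}
    {T : Module.End ℂ V} (hsymm : ∀ x ∈ W, ∀ y ∈ W, h x (T y) = h y (T x)) {x y : V} (hx : x ∈ W)
    (hy : y ∈ W) (hxy : h x (T y) ≠ 0) : ∃ w ∈ W, h w (T w) ≠ 0 := by
  by_contra! H
  have h1 := H _ (W.add_mem hx hy)
  simp only [map_add, LinearMap.add_apply, H x hx, H y hy, hsymm y hy x hx, zero_add,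
    add_zero] at h1
  exact hxy (self_eq_neg.mp (eq_neg_of_add_eq_zero_left h1))

/-- Pairing a relation between T x and T y with x and then with y kills its coefficients in turn.
This excludes the skew and mixed pairings when the rank of T is 1. -/
theorem two_le_finrank_range [FiniteDimensional ℂ V] {h : LinearMap.BilinForm ℂ V}
    {T : Module.End ℂ V} {x y : V} (hxx : h x (T x) = 0) (hxy : h x (T y) ≠ 0)
    (hyx : h y (T x) ≠ 0) : 2 ≤ finrank ℂ (LinearMap.range T) := by
  have li : LinearIndependent ℂ ![T x, T y] := by
    refine LinearIndependent.pair_iff.2 fun a b hab => ?_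
    have hb : b = 0 := by
      have := congrArg (h x) hab
      simpa [hxx, hxy] using this
    have ha : a = 0 := by
      have := congrArg (h y) hab
      simpa [hb, hyx] using this
    exact ⟨ha, hb⟩
  have h1 := finrank_span_eq_card li
  rw [Fintype.card_fin] at h1
  refine h1.symm.le.trans (Submodule.finrank_mono (Submodule.span_le.2 ?_))
  rintro _ ⟨i, rfl⟩
  fin_cases i
  · exact ⟨x, rfl⟩
  · exact ⟨y, rfl⟩

theorem exists_homogeneous_apply_ne_zero (hV : IsCompl V₀ V₁) {T : Module.End ℂ V} (hT : T ≠ 0) :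
    (∃ x ∈ V₀, T x ≠ 0) ∨ ∃ y ∈ V₁, T y ≠ 0 := by
  by_contra! H
  refine hT (LinearMap.ext fun v => ?_)
  obtain ⟨c, hc, d, hd, rfl⟩ := exists_homogeneous_parts hV v
  simp [H.1 c hc, H.2 d hd]

namespace IsOddOperator

variable {β h : LinearMap.BilinForm ℂ V} {D : Module.End ℂ V}
  (hD : IsOddOperator V₀ V₁ β h D) (hV : IsCompl V₀ V₁)

include hD hV

theorem exists_even_apply_ne_zero {a : V} (ha : a ∈ V₀) (h0 : a ≠ 0) :
    ∃ x ∈ V₀, h x a ≠ 0 := by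
  by_contra! H
  refine h0 (hD.nondeg a fun y => ?_)
  obtain ⟨c, hc, d, hd, rfl⟩ := exists_homogeneous_parts hV y
  rw [map_add, hD.even_odd a ha d hd, hD.even_even a ha c hc, H c hc, add_zero]

theorem exists_odd_apply_ne_zero {a : V} (ha : a ∈ V₁) (h0 : a ≠ 0) :
    ∃ x ∈ V₁, h x a ≠ 0 := by
  by_contra! H
  refine h0 (hD.nondeg a fun y => ?_)
  obtain ⟨c, hc, d, hd, rfl⟩ := exists_homogeneous_parts hV y
  rw [map_add, hD.odd_even a ha c hc, hD.odd_odd a ha d hd, H d hd, neg_zero, add_zero]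

theorem apply_sq_pow_even (j : ℕ) {x y : V} (hx : x ∈ V₀) (hy : y ∈ V₀) :
    h x (((D ^ 2) ^ j) y) = (-1) ^ j * h y (((D ^ 2) ^ j) x) := by
  rw [hD.even_even x hx _ (hD.sq_pow_map_even j hy), hD.sq_pow_skew hV]

theorem apply_sq_pow_odd (j : ℕ) {x y : V} (hx : x ∈ V₁) (hy : y ∈ V₁) :
    h x (((D ^ 2) ^ j) y) = -((-1) ^ j * h y (((D ^ 2) ^ j) x)) := by
  rw [hD.odd_odd x hx _ (hD.sq_pow_map_odd j hy), hD.sq_pow_skew hV]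

/-- An odd power of the odd operator pairs the even part with the odd part. -/
theorem exists_apply_sq_pow_map_ne_zero (j : ℕ) (hj : (D ^ 2) ^ j * D ≠ 0) :
    ∃ x ∈ V₀, ∃ y ∈ V₁, h x (((D ^ 2) ^ j * D) x) = 0 ∧ h x (((D ^ 2) ^ j * D) y) ≠ 0 ∧
      h y (((D ^ 2) ^ j * D) x) ≠ 0 := by
  have key : ∀ x ∈ V₀, ∀ y ∈ V₁, h x (((D ^ 2) ^ j * D) y) =
      -((-1) ^ j * h y (((D ^ 2) ^ j * D) x)) := by
    intro x hx y hy
    rw [Module.End.mul_apply, Module.End.mul_apply,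
      hD.odd_odd y hy _ (hD.sq_pow_map_odd j (hD.map_even x hx)), hD.sq_pow_skew hV,
      hD.apply_map_of_even hV hx, ← Module.End.mul_apply D, ← Module.End.mul_apply _ D,
      ← pow_mul, ← pow_succ, ← pow_succ', mul_neg, neg_neg, ← mul_assoc, ← mul_pow]
    simp
  have zero : ∀ x ∈ V₀, h x (((D ^ 2) ^ j * D) x) = 0 := fun x hx =>
    hD.even_odd x hx _ (hD.sq_pow_map_odd j (hD.map_even x hx))
  rcases exists_homogeneous_apply_ne_zero hV hj with ⟨x, hx, hx0⟩ | ⟨y, hy, hy0⟩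
  · obtain ⟨y, hy, hxy⟩ :=
      hD.exists_odd_apply_ne_zero hV (hD.sq_pow_map_odd j (hD.map_even x hx)) hx0
    exact ⟨x, hx, y, hy, zero x hx, by rw [key x hx y hy]; simpa using hxy, hxy⟩
  · obtain ⟨x, hx, hxy⟩ :=
      hD.exists_even_apply_ne_zero hV (hD.sq_pow_map_even j (hD.map_odd y hy)) hy0
    refine ⟨x, hx, y, hy, zero x hx, hxy, fun h0 => hxy ?_⟩
    change h x (((D ^ 2) ^ j * D) y) = 0
    rw [key x hx y hy, h0, mul_zero, neg_zero]

variable [FiniteDimensional ℂ V] (hirr : IsIrreducible V₀ V₁ β)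
    (hs : IsSupersymmetric V₀ V₁ β)
    {k m : ℕ} (e : Basis (Fin k) ℂ V₀) (f : Basis (Fin m) ℂ V₁)

include hirr hs

theorem exists_isListed_one_two_of_ne {y : V} (hy : y ∈ V₁) (h3 : D (D (D y)) = 0)
    (h2 : h y (D (D y)) ≠ 0) :
    ∃ B : Matrix (Fin k) (Fin m) ℂ, IsListed k m B ∧ FormEquiv V₀ V₁ β (gramForm hV e f B) := by
  obtain ⟨s, hs'⟩ := exists_sq_mul_eq _ (-1) h2
  exact hD.exists_isListed_one_two hV hirr hs e f (y := s • y) (V₁.smul_mem _ hy) (by simp [h3])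
    (by simpa using hs')

theorem exists_isListed_three_two_of_ne {x : V} (hx : x ∈ V₀)
    (h5 : D (D (D (D (D x)))) = 0) (h4 : h x (D (D (D (D x)))) ≠ 0) :
    ∃ B : Matrix (Fin k) (Fin m) ℂ, IsListed k m B ∧ FormEquiv V₀ V₁ β (gramForm hV e f B) := by
  have key : ∀ x ∈ V₀, D (D (D (D (D x)))) = 0 → h x (D (D (D (D x)))) = -1 →
      ∃ B : Matrix (Fin k) (Fin m) ℂ, IsListed k m B ∧
        FormEquiv V₀ V₁ β (gramForm hV e f B) := by
    intro x hx h5 h4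
    have mx4 : D (D (D (D x))) ∈ V₀ :=
      hD.map_odd _ (hD.map_even _ (hD.map_odd _ (hD.map_even _ hx)))
    have h4' : h (D (D (D (D x)))) x = -1 := by rw [hD.even_even _ mx4 x hx, h4]
    have h44 : h (D (D (D (D x)))) (D (D (D (D x)))) = 0 := by
      rw [← hD.apply_map_of_even hV mx4, h5]; simp
    -- As D⁴x is isotropic and pairs to -1 with x, adding c D⁴x changes h(x, x) by -2c.
    refine hD.exists_isListed_three_two hV hirr hs e f (x := x + (h x x / 2) • D (D (D (D x))))
      (V₀.add_mem hx (V₀.smul_mem _ mx4)) ?_ ?_ ?_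
    · simp [h5]
    · simp [h4, h4', h44]
      ring
    · simp [h4, h44, h5]
  obtain ⟨s, hs'⟩ := exists_sq_mul_eq _ (-1) h4
  exact key (s • x) (V₀.smul_mem _ hx) (by simp [h5]) (by simpa using hs')

theorem exists_isListed_three_four_of_ne {y : V} (hy : y ∈ V₁)
    (h7 : D (D (D (D (D (D (D y)))))) = 0) (h6 : h y (D (D (D (D (D (D y)))))) ≠ 0) :
    ∃ B : Matrix (Fin k) (Fin m) ℂ, IsListed k m B ∧ FormEquiv V₀ V₁ β (gramForm hV e f B) := by
  have key : ∀ y ∈ V₁, D (D (D (D (D (D (D y)))))) = 0 → h y (D (D (D (D (D (D y)))))) = 1 →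
      ∃ B : Matrix (Fin k) (Fin m) ℂ, IsListed k m B ∧
        FormEquiv V₀ V₁ β (gramForm hV e f B) := by
    intro y hy h7 h6
    have sk := hD.sq_skew hV
    have my4 : D (D (D (D y))) ∈ V₁ :=
      hD.map_even _ (hD.map_odd _ (hD.map_even _ (hD.map_odd _ hy)))
    -- Adding c D⁴y changes h(y, D²y) by 2c and leaves h(y, D⁶y) alone; c is chosen to reach -1.
    refine hD.exists_isListed_three_four hV hirr hs e f
      (y := y + (-(1 + h y (D (D y))) / 2) • D (D (D (D y))))
      (V₁.add_mem hy (V₁.smul_mem _ my4)) ?_ ?_ ?_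
    · simp [h7]
    · simp [sk, h6, h7]
      ring
    · simp [sk, h6, h7]
  obtain ⟨s, hs'⟩ := exists_sq_mul_eq _ 1 h6
  exact key (s • y) (V₁.smul_mem _ hy) (by simp [h7]) (by simpa using hs')

theorem exists_isListed_two_two_of_ne {x y : V} (hx : x ∈ V₀) (hy : y ∈ V₁)
    (hx2 : D (D x) = 0) (hy2 : D (D y) = 0) (h1 : h x (D y) ≠ 0) :
    ∃ B : Matrix (Fin k) (Fin m) ℂ, IsListed k m B ∧ FormEquiv V₀ V₁ β (gramForm hV e f B) := by
  have key : ∀ y ∈ V₁, D (D y) = 0 → h x (D y) = 1 →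
      ∃ B : Matrix (Fin k) (Fin m) ℂ, IsListed k m B ∧
        FormEquiv V₀ V₁ β (gramForm hV e f B) := by
    intro y hy hy2 h1
    have my1 := hD.map_odd y hy
    have h1' : h (D y) x = 1 := by rw [hD.even_even _ my1 x hx, h1]
    have h11 : h (D y) (D y) = 0 := by rw [hD.apply_map_of_odd hV hy, hy2]; simp
    refine hD.exists_isListed_two_two hV hirr hs e f (x := x + (-h x x / 2) • D y) (y := y)
      (V₀.add_mem hx (V₀.smul_mem _ my1)) hy ?_ hy2 ?_ ?_
    · simp [hx2, hy2]
    · simp [h1, h1', h11]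
      ring
    · simp [h1, h11]
  exact key ((h x (D y))⁻¹ • y) (V₁.smul_mem _ hy) (by simp [hy2]) (by simp [h1])

theorem exists_isListed_four_two_of_ne {x y : V} (hx : x ∈ V₀) (hy : y ∈ V₀)
    (hx3 : D (D (D x)) = 0) (hy3 : D (D (D y)) = 0) (h2 : h x (D (D y)) ≠ 0) :
    ∃ B : Matrix (Fin k) (Fin m) ℂ, IsListed k m B ∧ FormEquiv V₀ V₁ β (gramForm hV e f B) := by
  have key : ∀ y ∈ V₀, D (D (D y)) = 0 → h x (D (D y)) = 1 →
      ∃ B : Matrix (Fin k) (Fin m) ℂ, IsListed k m B ∧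
        FormEquiv V₀ V₁ β (gramForm hV e f B) := by
    intro y hy hy3 h2
    have sk := hD.sq_skew hV
    have mx2 := hD.map_odd _ (hD.map_even x hx)
    have my2 := hD.map_odd _ (hD.map_even y hy)
    have h2' : h y (D (D x)) = -1 := by rw [hD.even_even y hy _ mx2, sk, h2]
    have hx2 : h x (D (D x)) = 0 := by
      have := hD.even_even x hx _ mx2
      rw [sk] at this
      exact self_eq_neg.mp this
    have hy2 : h y (D (D y)) = 0 := by
      have := hD.even_even y hy _ my2
      rw [sk] at this
      exact self_eq_neg.mp this
    -- The corrections cancel h(x, x), h(y, y) and h(x, y) in turn; h(x, D²x) and h(y, D²y) vanish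
    -- because D² is skew.
    refine hD.exists_isListed_four_two hV hirr hs e f (x := x + (-h x x / 2) • D (D y))
      (y := y + (h y y / 2) • D (D x) - (h x y) • D (D y))
      (V₀.add_mem hx (V₀.smul_mem _ my2))
      (V₀.sub_mem (V₀.add_mem hy (V₀.smul_mem _ mx2)) (V₀.smul_mem _ my2)) ?_ ?_ ?_ ?_ ?_ ?_
    · simp [hx3, hy3]
    · simp [hx3, hy3]
    · simp [sk, hy3, h2, h2']
      ring
    · simp [sk, hx3, hy3, h2, h2', hy2]
      ring
    · simp [sk, hx3, hy3, h2, hx2, hy2]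
    · simp [sk, hx3, hy3, h2]
  exact key ((h x (D (D y)))⁻¹ • y) (V₀.smul_mem _ hy) (by simp [hy3]) (by simp [h2])

theorem exists_isListed_of_isNilpotent (hdim : finrank ℂ V ≤ 7) (hnil : IsNilpotent D)
    (hD0 : D ≠ 0) :
    ∃ B : Matrix (Fin k) (Fin m) ℂ, IsListed k m B ∧ FormEquiv V₀ V₁ β (gramForm hV e f B) := by
  obtain ⟨n, hn, hn1⟩ : ∃ n, D ^ n ≠ 0 ∧ D ^ (n + 1) = 0 := by
    classical
    have hspec := Nat.find_spec hnil
    obtain ⟨l, hl⟩ : ∃ l, Nat.find hnil = l + 1 := by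
      refine Nat.exists_eq_succ_of_ne_zero fun h0 => hD0 ?_
      rw [h0, pow_zero] at hspec
      rw [← mul_one D, hspec, mul_zero]
    exact ⟨l, Nat.find_min hnil (by omega), hl ▸ hspec⟩
  have hrank := finrank_range_pow_mul_le D n hn1
  have hpos : 1 ≤ finrank ℂ (LinearMap.range (D ^ n)) := by
    rw [Submodule.one_le_finrank_iff]
    exact fun h0 => hn (LinearMap.range_eq_bot.1 h0)
  have hn6 : n ≤ 6 := by nlinarith
  -- Two blocks of size n + 1 ≥ 4 would need dimension 8.
  have hrank2 : 3 ≤ n → ¬ 2 ≤ finrank ℂ (LinearMap.range (D ^ n)) := fun h3 h2 => by nlinarith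
  have hn0 : n ≠ 0 := by
    rintro rfl
    exact hD0 (by simpa using hn1)
  have hz : ∀ v, (D ^ (n + 1)) v = 0 := fun v => by rw [hn1, LinearMap.zero_apply]
  interval_cases n
  · exact absurd rfl hn0
  · obtain ⟨x, hx, y, hy, -, hxy, -⟩ := hD.exists_apply_sq_pow_map_ne_zero hV 0 (by simpa using hn)
    exact hD.exists_isListed_two_two_of_ne hV hirr hs e f hx hy (hz x) (hz y) hxy
  · rw [show D ^ 2 = (D ^ 2) ^ 1 from (pow_one _).symm] at hn
    rcases exists_homogeneous_apply_ne_zero hV hn with ⟨y, hy, hy0⟩ | ⟨y, hy, hy0⟩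
    · obtain ⟨x, hx, hxy⟩ := hD.exists_even_apply_ne_zero hV (hD.sq_pow_map_even 1 hy) hy0
      exact hD.exists_isListed_four_two_of_ne hV hirr hs e f hx hy (hz x) (hz y) hxy
    · obtain ⟨x, hx, hxy⟩ := hD.exists_odd_apply_ne_zero hV (hD.sq_pow_map_odd 1 hy) hy0
      obtain ⟨w, hw, hww⟩ := exists_apply_self_ne_zero
        (fun x hx y hy => (hD.apply_sq_pow_odd hV 1 hx hy).trans (by simp)) hx hy hxy
      exact hD.exists_isListed_one_two_of_ne hV hirr hs e f hw (hz w) hww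
  · obtain ⟨x, hx, y, hy, hxx, hxy, hyx⟩ := hD.exists_apply_sq_pow_map_ne_zero hV 1 hn
    exact absurd (two_le_finrank_range hxx hxy hyx) (hrank2 le_rfl)
  · rw [show D ^ 4 = (D ^ 2) ^ 2 from (pow_mul D 2 2)] at hn hrank2
    rcases exists_homogeneous_apply_ne_zero hV hn with ⟨y, hy, hy0⟩ | ⟨y, hy, hy0⟩
    · obtain ⟨x, hx, hxy⟩ := hD.exists_even_apply_ne_zero hV (hD.sq_pow_map_even 2 hy) hy0
      obtain ⟨w, hw, hww⟩ := exists_apply_self_ne_zero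
        (fun x hx y hy => (hD.apply_sq_pow_even hV 2 hx hy).trans (by simp)) hx hy hxy
      exact hD.exists_isListed_three_two_of_ne hV hirr hs e f hw (hz w) hww
    · obtain ⟨x, hx, hxy⟩ := hD.exists_odd_apply_ne_zero hV (hD.sq_pow_map_odd 2 hy) hy0
      have sk : ∀ {x y : V}, x ∈ V₁ → y ∈ V₁ →
          h x (((D ^ 2) ^ 2) y) = -h y (((D ^ 2) ^ 2) x) := fun hx hy =>
        (hD.apply_sq_pow_odd hV 2 hx hy).trans (by simp)
      refine absurd (two_le_finrank_range (self_eq_neg.mp (sk hx hx)) hxy ?_) (hrank2 (by norm_num))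
      rwa [sk hy hx, neg_ne_zero]
  · rw [show D ^ 5 = (D ^ 2) ^ 2 * D by rw [← pow_mul, ← pow_succ]] at hn hrank2
    obtain ⟨x, hx, y, hy, hxx, hxy, hyx⟩ := hD.exists_apply_sq_pow_map_ne_zero hV 2 hn
    exact absurd (two_le_finrank_range hxx hxy hyx) (hrank2 (by norm_num))
  · rw [show D ^ 6 = (D ^ 2) ^ 3 from (pow_mul D 2 3)] at hn hrank2
    rcases exists_homogeneous_apply_ne_zero hV hn with ⟨y, hy, hy0⟩ | ⟨y, hy, hy0⟩
    · obtain ⟨x, hx, hxy⟩ := hD.exists_even_apply_ne_zero hV (hD.sq_pow_map_even 3 hy) hy0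
      have sk : ∀ {x y : V}, x ∈ V₀ → y ∈ V₀ →
          h x (((D ^ 2) ^ 3) y) = -h y (((D ^ 2) ^ 3) x) := fun hx hy =>
        (hD.apply_sq_pow_even hV 3 hx hy).trans (by simp [pow_succ])
      refine absurd (two_le_finrank_range (self_eq_neg.mp (sk hx hx)) hxy ?_) (hrank2 (by norm_num))
      rwa [sk hy hx, neg_ne_zero]
    · obtain ⟨x, hx, hxy⟩ := hD.exists_odd_apply_ne_zero hV (hD.sq_pow_map_odd 3 hy) hy0
      obtain ⟨w, hw, hww⟩ := exists_apply_self_ne_zero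
        (fun x hx y hy => (hD.apply_sq_pow_odd hV 3 hx hy).trans (by simp [pow_succ])) hx hy hxy
      exact hD.exists_isListed_three_four_of_ne hV hirr hs e f hw (hz w) hww

end IsOddOperator

end Nilpotent

/-! ### Injective odd operator: determinants and size (2|2) -/

section Invertible

theorem blockJ_two : blockJ 2 = !![0, 1; -1, 0] := by
  ext i j
  fin_cases i <;> fin_cases j <;> simp [blockJ]

theorem transpose_mul_blockJ_two_mul (Y : Matrix (Fin 2) (Fin 2) ℂ) :
    Yᵀ * blockJ 2 * Y = Y.det • blockJ 2 := by
  rw [blockJ_two]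
  ext i j
  fin_cases i <;> fin_cases j <;>
    simp [Matrix.mul_apply, Fin.sum_univ_two, Matrix.det_fin_two] <;> ring

theorem mem_CPlus_or_neg_mem {z : ℂ} (hz : z ≠ 0) : z ∈ CPlus ∨ -z ∈ CPlus := by
  simp only [CPlus, Set.mem_ofPred_eq, Complex.neg_re, Complex.neg_im]
  rcases lt_trichotomy z.re 0 with h | h | h
  · right; left; linarith
  · rcases lt_trichotomy z.im 0 with h' | h' | h'
    · right; right; exact ⟨by linarith, by linarith⟩
    · exact absurd (Complex.ext h h') hz
    · left; right; exact ⟨h, h'⟩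
  · left; left; exact h

theorem neg_notMem_CPlus {z : ℂ} (hz : z ∈ CPlus) : -z ∉ CPlus := by
  simp only [CPlus, Set.mem_ofPred_eq, Complex.neg_re, Complex.neg_im] at hz ⊢
  rintro (h | ⟨h, h'⟩) <;> rcases hz with g | ⟨g, g'⟩ <;> linarith

/-- Solving B' = Xᵀ B Y gives Y = B⁻¹ X B', of determinant (det X)² = 1, and Sp(2) = SL(2). -/
theorem sameOrbit_of_det_eq {B B' X : Matrix (Fin 2) (Fin 2) ℂ} (hB : B.det ≠ 0)
    (hX : Xᵀ * X = 1) (hdet : B'.det = X.det * B.det) : SameOrbit B B' := by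
  have hdX : X.det * X.det = 1 := by
    have := congrArg Matrix.det hX
    rwa [Matrix.det_mul, Matrix.det_transpose, Matrix.det_one] at this
  have hBu : IsUnit B.det := isUnit_iff_ne_zero.2 hB
  have hdY : (B⁻¹ * (X * B')).det = 1 := by
    rw [Matrix.det_mul, Matrix.det_mul, hdet, Matrix.det_nonsing_inv, ← mul_assoc X.det, hdX,
      one_mul, Ring.inverse_mul_cancel _ hBu]
  refine ⟨X, B⁻¹ * (X * B'), hX, ?_, ?_, ?_⟩
  · rw [Matrix.isUnit_iff_isUnit_det, hdY]
    exact isUnit_one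
  · rw [transpose_mul_blockJ_two_mul, hdY, one_smul]
  · rw [mul_assoc, ← mul_assoc B, Matrix.mul_nonsing_inv B hBu, one_mul, ← mul_assoc, hX, one_mul]

theorem exists_isListed_sameOrbit_of_det_ne_zero (B : Matrix (Fin 2) (Fin 2) ℂ)
    (hB : B.det ≠ 0) : ∃ B', IsListed 2 2 B' ∧ SameOrbit B B' := by
  rcases mem_CPlus_or_neg_mem hB with h | h
  · exact ⟨_, IsListed.B₂ _ h, sameOrbit_of_det_eq (X := 1) hB (by simp)
      (by simp [Matrix.det_fin_two])⟩
  -- A reflection flips the sign of the determinant into `CPlus`.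
  · refine ⟨_, IsListed.B₂ _ h, sameOrbit_of_det_eq (X := !![1, 0; 0, -1]) hB ?_ ?_⟩
    · ext i j
      fin_cases i <;> fin_cases j <;> simp [Matrix.mul_apply, Fin.sum_univ_two]
    · simp [Matrix.det_fin_two]

theorem SameOrbit.det_eq_or_eq_neg {B B' : Matrix (Fin 2) (Fin 2) ℂ} (h : SameOrbit B B') :
    B'.det = B.det ∨ B'.det = -B.det := by
  obtain ⟨X, Y, hX, -, hY, rfl⟩ := h
  have hdX : X.det * X.det = 1 := by
    have := congrArg Matrix.det hX
    rwa [Matrix.det_mul, Matrix.det_transpose, Matrix.det_one] at this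
  have hdY : Y.det = 1 := by
    rw [transpose_mul_blockJ_two_mul] at hY
    simpa [blockJ] using congrFun (congrFun hY 0) 1
  rw [Matrix.det_mul, Matrix.det_mul, hdY, mul_one, Matrix.det_transpose]
  rcases mul_self_eq_one_iff.1 hdX with h | h <;> simp [h]

theorem IsListed.even {k m : ℕ} {B : Matrix (Fin k) (Fin m) ℂ} (h : IsListed k m B) : Even m := by
  cases h <;> decide

theorem IsListed.ne_zero {k m : ℕ} {B : Matrix (Fin k) (Fin m) ℂ} (h : IsListed k m B) :
    B ≠ 0 := by
  intro h0
  cases h with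
  | B₁ => simpa using congrFun (congrFun h0 0) 0
  | B₂ α hα => simpa using congrFun (congrFun h0 0) 0
  | B₃ => simpa using congrFun (congrFun h0 0) 0
  | B₄ => simpa using congrFun (congrFun h0 0) 0
  | B₅ => simpa using congrFun (congrFun h0 0) 0
  | B₆ => simpa using congrFun (congrFun h0 0) 0

/-- Only size (2|2) needs an argument: det is α for `B₂` and 0 for `B₃`, and it is invariant up to
sign. -/
theorem IsListed.eq_of_sameOrbit {k m : ℕ} {B B' : Matrix (Fin k) (Fin m) ℂ} (h : IsListed k m B)
    (h' : IsListed k m B') (hBB' : SameOrbit B B') : B = B' := by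
  have zero : (0 : ℂ) ∉ CPlus := by simp [CPlus]
  cases h <;> cases h' <;> try rfl
  · next α hα γ hγ =>
    have := hBB'.det_eq_or_eq_neg
    simp only [Matrix.det_fin_two_of, one_mul, mul_zero, sub_zero] at this
    rcases this with rfl | rfl
    · rfl
    · exact absurd hγ (neg_notMem_CPlus hα)
  · next α hα =>
    have := hBB'.det_eq_or_eq_neg
    simp only [Matrix.det_fin_two_of, one_mul, mul_zero, zero_mul, sub_zero] at this
    rcases this with h | h
    · exact absurd (h ▸ hα) zero
    · exact absurd (neg_eq_zero.1 h.symm ▸ hα) zero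
  · next α hα =>
    have := hBB'.det_eq_or_eq_neg
    simp only [Matrix.det_fin_two_of, one_mul, mul_zero, zero_mul, sub_zero, neg_zero,
      or_self] at this
    exact absurd (this ▸ hα) zero

variable {V : Type*} [AddCommGroup V] [Module ℂ V] {V₀ V₁ : Submodule ℂ V}

theorem IsOddOperator.exists_isListed_of_injective [FiniteDimensional ℂ V]
    {β h : LinearMap.BilinForm ℂ V} {D : Module.End ℂ V}
    (hD : IsOddOperator V₀ V₁ β h D) (hV : IsCompl V₀ V₁) (hβ : IsPreOscillator V₀ V₁ β)
    {k m : ℕ} (hdim : k + m ≤ 7) (e : Basis (Fin k) ℂ V₀) (f : Basis (Fin m) ℂ V₁)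
    (hinj : Function.Injective D) :
    ∃ B : Matrix (Fin k) (Fin m) ℂ, IsListed k m B ∧ FormEquiv V₀ V₁ β (gramForm hV e f B) := by
  obtain ⟨hm, B, hB, heq⟩ := (isPreOscillator_iff e f hV β).1 hβ
  -- D embeds `V₀` in `V₁` and `V₁` in `V₀`, hence k = m.
  have h01 := LinearMap.finrank_le_finrank_of_injective (f := D.restrict hD.map_even)
    fun x y hxy => Subtype.ext (hinj (congrArg Subtype.val hxy))
  have h10 := LinearMap.finrank_le_finrank_of_injective (f := D.restrict hD.map_odd)
    fun x y hxy => Subtype.ext (hinj (congrArg Subtype.val hxy))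
  rw [finrank_eq_card_basis e, finrank_eq_card_basis f, Fintype.card_fin, Fintype.card_fin]
    at h01 h10
  have hm0 : m ≠ 0 := by
    rintro rfl
    exact hB (Matrix.ext fun i j => j.elim0)
  obtain rfl : k = m := le_antisymm h01 h10
  obtain rfl : k = 2 := by
    obtain ⟨r, rfl⟩ := hm
    omega
  -- A kernel vector of B would be an odd vector orthogonal to `V₀`, carried by φ into the kernel of
  -- D.
  have hdet : B.det ≠ 0 := by
    intro h0
    obtain ⟨a, ha0, ha⟩ := Matrix.exists_mulVec_eq_zero_iff.2 h0
    obtain ⟨φ, φ0, φ1, hφ⟩ := heq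
    let w : V₁ := ∑ j, a j • f j
    have hw : ∀ x ∈ V₀, gramForm hV e f B x w = 0 := by
      intro x hx
      have : ((gramForm hV e f B).flip w).domRestrict V₀ = 0 := e.ext fun i => by
        have := congrFun ha i
        simpa [w, Matrix.mulVec, dotProduct, LinearMap.domRestrict_apply, mul_comm] using this
      exact LinearMap.congr_fun this ⟨x, hx⟩
    have hφw : φ w ∈ V₁ := (mem_map_iff_of_map_eq φ1 _).2 w.2
    have hDw : D (φ w) = 0 := by
      by_contra hne
      obtain ⟨x, hx, hxw⟩ := hD.exists_even_apply_ne_zero hV (hD.map_odd _ hφw) hne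
      have h2 := hD.apply_eq x (φ w)
      rw [hD.even_odd x hx _ hφw, zero_add, hD.adj_even x hx _ hφw, ← φ.apply_symm_apply x, hφ,
        hw _ ((mem_map_iff_of_map_eq φ0 _).1 (by simpa using hx)), φ.apply_symm_apply] at h2
      exact hxw h2.symm
    have hw0 : w = 0 := by
      have h3 := hinj (hDw.trans (map_zero D).symm)
      simpa using h3
    exact ha0 (funext (Fintype.linearIndependent_iff.1 f.linearIndependent a hw0))
  obtain ⟨B', hB', ho⟩ := exists_isListed_sameOrbit_of_det_ne_zero B hdet
  exact ⟨B', hB', heq.trans ((formEquiv_gramForm_iff e f hV hm B B').2 ho)⟩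

end Invertible

/-! ### Irreducibility of the listed forms -/

section Irreducibility

variable {V : Type*} [AddCommGroup V] [Module ℂ V] {V₀ V₁ : Submodule ℂ V}

theorem IsSubsuperspace.exists_parts {U : Submodule ℂ V} (hU : IsSubsuperspace V₀ V₁ U) {u : V}
    (hu : u ∈ U) : ∃ a ∈ U, ∃ b ∈ U, a ∈ V₀ ∧ b ∈ V₁ ∧ a + b = u := by
  rw [hU] at hu
  obtain ⟨a, ha, b, hb, hab⟩ := Submodule.mem_sup.1 hu
  exact ⟨a, ha.1, b, hb.1, ha.2, hb.2, hab⟩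

theorem IsSupersymmetric.orthogonal_symm {β : LinearMap.BilinForm ℂ V}
    (hβ : IsSupersymmetric V₀ V₁ β) {U W : Submodule ℂ V} (hU : IsSubsuperspace V₀ V₁ U)
    (hW : IsSubsuperspace V₀ V₁ W) (ho : ∀ u ∈ U, ∀ w ∈ W, β u w = 0) :
    ∀ w ∈ W, ∀ u ∈ U, β w u = 0 := by
  intro w hw u hu
  obtain ⟨a, haU, b, hbU, ha, hb, rfl⟩ := hU.exists_parts hu
  obtain ⟨c, hcW, d, hdW, hc, hd, rfl⟩ := hW.exists_parts hw
  simp [hβ.even_even c hc a ha, hβ.even_odd c hc b hb, ← hβ.even_odd a ha d hd,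
    hβ.odd_odd d hd b hb, ho a haU c hcW, ho b hbU c hcW, ho a haU d hdW, ho b hbU d hdW]

/-- A form with two-dimensional odd part is irreducible if the even vectors orthogonal to the odd
part are isotropic. -/
theorem isIrreducible_of_finrank_odd_eq_two (hV : IsCompl V₀ V₁) {β : LinearMap.BilinForm ℂ V}
    (hs : IsSupersymmetric V₀ V₁ β) (n0 : (β.restrict V₀).Nondegenerate)
    (n1 : (β.restrict V₁).Nondegenerate) (h2 : finrank ℂ V₁ = 2)
    (hiso : ∀ x ∈ V₀, (∀ y ∈ V₁, β x y = 0) → β x x = 0) : IsIrreducible V₀ V₁ β := by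
  have : FiniteDimensional ℂ V₁ := FiniteDimensional.of_finrank_pos (by omega)
  rintro ⟨U, W, hU, hW, hU0, hW0, hUW, ho⟩
  have ho' := hs.orthogonal_symm hU hW ho
  -- No summand is purely even: such a `W` would be orthogonal to `V₁`, hence totally isotropic, and
  -- also orthogonal to its complement, against nondegeneracy on `V₀`.
  have key : ∀ U W : Submodule ℂ V, IsSubsuperspace V₀ V₁ U → IsSubsuperspace V₀ V₁ W →
      W ≠ ⊥ → IsCompl U W → (∀ u ∈ U, ∀ w ∈ W, β u w = 0) → (∀ w ∈ W, ∀ u ∈ U, β w u = 0) →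
      ¬ ∀ w ∈ W, w ∈ V₁ → w = 0 := by
    intro U W hU hW hW0 hUW ho ho' H
    have hWV : W ≤ V₀ := fun w hw => by
      obtain ⟨a, haW, b, hbW, ha, hb, rfl⟩ := hW.exists_parts hw
      rw [H b hbW hb, add_zero]
      exact ha
    have hVU : V₁ ≤ U := fun y hy => by
      obtain ⟨u, hu, w, hw, rfl⟩ := exists_homogeneous_parts hUW y
      obtain ⟨a, haU, b, hbU, ha, hb, rfl⟩ := hU.exists_parts hu
      have := (eq_zero_of_even_odd hV (V₀.add_mem ha (hWV hw)) (V₁.sub_mem hb hy)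
        (by abel)).2
      rwa [← sub_eq_zero.1 this]
    have hself : ∀ w ∈ W, β w w = 0 := fun w hw =>
      hiso w (hWV hw) fun y hy => ho' w hw y (hVU hy)
    refine hW0 ((Submodule.eq_bot_iff _).2 fun w hw => ?_)
    refine congrArg Subtype.val (n0.1 ⟨w, hWV hw⟩ fun x => ?_)
    change β w x = 0
    obtain ⟨u, hu, w', hw', hx⟩ := exists_homogeneous_parts hUW (x : V)
    rw [← hx, map_add, ho' w hw u hu, zero_add]
    have h1 := hself _ (W.add_mem hw hw')
    simp only [map_add, LinearMap.add_apply, hself w hw, hself w' hw', zero_add, add_zero,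
      hs.even_even w' (hWV hw') w (hWV hw)] at h1
    exact self_eq_neg.mp (eq_neg_of_add_eq_zero_left h1)
  have hu := key W U hW hU hU0 hUW.symm ho' ho
  have hw := key U W hU hW hW0 hUW ho ho'
  push Not at hu hw
  obtain ⟨u, hu, hu1, hune⟩ := hu
  obtain ⟨w, hw, hw1, hwne⟩ := hw
  have huu : β u u = 0 := self_eq_neg.mp (hs.odd_odd u hu1 u hu1)
  -- Odd vectors from the two summands form a basis of `V₁`, and `u` is orthogonal to both,
  -- contradicting nondegeneracy there.
  have li : LinearIndependent ℂ ![(⟨u, hu1⟩ : V₁), ⟨w, hw1⟩] := by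
    refine LinearIndependent.pair_iff.2 fun a b hab => ?_
    have hab' : a • u + b • w = 0 := congrArg Subtype.val hab
    have := eq_zero_of_even_odd hUW (U.smul_mem a hu) (W.smul_mem b hw) hab'
    exact ⟨(smul_eq_zero.1 this.1).resolve_right hune, (smul_eq_zero.1 this.2).resolve_right hwne⟩
  have hspan := li.span_eq_top_of_card_eq_finrank' (by simp [h2])
  refine hune (congrArg Subtype.val (n1.1 ⟨u, hu1⟩ fun y => ?_))
  have : (β.restrict V₁ ⟨u, hu1⟩) = 0 := by
    refine LinearMap.ext_on_range hspan fun i => ?_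
    fin_cases i
    · exact huu
    · exact ho u hu w hw
  rw [this, LinearMap.zero_apply]

/-- Comparing parts of equal parity turns β-orthogonality into h-orthogonality. The `W`-component of
D u then pairs to zero with both summands. -/
theorem IsOddOperator.map_mem_of_isCompl {β h : LinearMap.BilinForm ℂ V} {D : Module.End ℂ V}
    (hD : IsOddOperator V₀ V₁ β h D) {U W : Submodule ℂ V}
    (hU : IsSubsuperspace V₀ V₁ U) (hW : IsSubsuperspace V₀ V₁ W) (hUW : IsCompl U W)
    (ho : ∀ u ∈ U, ∀ w ∈ W, β u w = 0) (ho' : ∀ w ∈ W, ∀ u ∈ U, β w u = 0) :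
    ∀ u ∈ U, D u ∈ U := by
  have key : ∀ U W : Submodule ℂ V, IsSubsuperspace V₀ V₁ U → IsSubsuperspace V₀ V₁ W →
      (∀ u ∈ U, ∀ w ∈ W, β u w = 0) → ∀ u ∈ U, ∀ w ∈ W, h u w = 0 := by
    intro U W hU hW ho u hu w hw
    obtain ⟨a, haU, b, hbU, ha, hb, rfl⟩ := hU.exists_parts hu
    obtain ⟨c, hcW, d, hdW, hc, hd, rfl⟩ := hW.exists_parts hw
    have h1 := hD.apply_eq a c
    have h2 := hD.apply_eq b d
    rw [ho a haU c hcW, hD.odd_even _ (hD.map_even a ha) c hc, add_zero] at h1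
    rw [ho b hbU d hdW, hD.even_odd _ (hD.map_odd b hb) d hd, add_zero] at h2
    simp [← h1, ← h2, hD.even_odd a ha d hd, hD.odd_even b hb c hc]
  have hUW0 := key U W hU hW ho
  have hWU0 := key W U hW hU ho'
  intro u hu
  obtain ⟨v, hv, w, hw, hvw⟩ := exists_homogeneous_parts hUW (D u)
  have hw0 : w = 0 := by
    refine hD.nondeg w fun y => ?_
    obtain ⟨v', hv', w', hw', rfl⟩ := exists_homogeneous_parts hUW y
    have h1 := hD.apply_eq u w'
    rw [ho u hu w' hw', hUW0 u hu w' hw', zero_add, ← hvw, map_add, LinearMap.add_apply,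
      hUW0 v hv w' hw', zero_add] at h1
    rw [map_add, hWU0 w hw v' hv', ← h1, add_zero]
  rw [← hvw, hw0, add_zero]
  exact hv

/-- The last nonzero iterate of D on any nonzero vector lies in the kernel, so both summands would
contain z; then z = 0 and D is both injective and nilpotent. -/
theorem isIrreducible_of_ker_le_span {β h : LinearMap.BilinForm ℂ V} {D : Module.End ℂ V}
    (hD : IsOddOperator V₀ V₁ β h D) (hs : IsSupersymmetric V₀ V₁ β) (hnil : IsNilpotent D)
    {z : V} (hz : LinearMap.ker D ≤ Submodule.span ℂ {z}) : IsIrreducible V₀ V₁ β := by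
  classical
  rintro ⟨U, W, hU, hW, hU0, hW0, hUW, ho⟩
  have ho' := hs.orthogonal_symm hU hW ho
  have key : ∀ U : Submodule ℂ V, (∀ u ∈ U, D u ∈ U) → U ≠ ⊥ → z ∈ U := by
    intro U hDU hU0
    obtain ⟨u, hu, hune⟩ := (Submodule.ne_bot_iff U).1 hU0
    have hex : ∃ n, (D ^ n) u = 0 := hnil.imp fun n hn => by rw [hn, LinearMap.zero_apply]
    obtain ⟨l, hl⟩ : ∃ l, Nat.find hex = l + 1 := by
      refine Nat.exists_eq_succ_of_ne_zero fun h0 => hune ?_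
      simpa [h0] using Nat.find_spec hex
    have h1 : (D ^ l) u ≠ 0 := Nat.find_min hex (by omega)
    have h2 : (D ^ (l + 1)) u = 0 := hl ▸ Nat.find_spec hex
    have hmem : ∀ n, (D ^ n) u ∈ U := by
      intro n
      induction n with
      | zero => simpa
      | succ n ih =>
        rw [pow_succ', Module.End.mul_apply]
        exact hDU _ ih
    rw [pow_succ', Module.End.mul_apply] at h2
    obtain ⟨c, hc⟩ := Submodule.mem_span_singleton.1 (hz (LinearMap.mem_ker.2 h2))
    have hc0 : c ≠ 0 := by
      rintro rfl
      exact h1 (by rw [← hc, zero_smul])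
    have := U.smul_mem c⁻¹ (hc ▸ hmem l)
    rwa [inv_smul_smul₀ hc0] at this
  have hzU := key U (hD.map_mem_of_isCompl hU hW hUW ho ho') hU0
  have hzW := key W (hD.map_mem_of_isCompl hW hU hUW.symm ho' ho) hW0
  have hz0 : z = 0 := Submodule.disjoint_def.1 hUW.disjoint z hzU hzW
  have hker : LinearMap.ker D = ⊥ := by
    rw [hz0, Submodule.span_zero_singleton] at hz
    exact le_bot_iff.1 hz
  obtain ⟨n, hn⟩ := hnil
  have hinj : Function.Injective (D ^ n) := by
    rw [Module.End.coe_pow]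
    exact (LinearMap.ker_eq_bot.1 hker).iterate n
  obtain ⟨u, hu, hune⟩ := (Submodule.ne_bot_iff U).1 hU0
  exact hune (hinj (by rw [hn]; simp))

variable (hV : IsCompl V₀ V₁)

theorem isIrreducible_gramForm_of_isotropic {k : ℕ} (e : Basis (Fin k) ℂ V₀)
    (f : Basis (Fin 2) ℂ V₁) (B : Matrix (Fin k) (Fin 2) ℂ) (hB0 : B ≠ 0)
    (hB : ∀ a : Fin k → ℂ, a ᵥ* B = 0 → a ⬝ᵥ a = 0) :
    IsIrreducible V₀ V₁ (gramForm hV e f B) := by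
  have hp := isPreOscillator_gramForm hV e f B even_two hB0
  refine isIrreducible_of_finrank_odd_eq_two hV hp.supersymmetric hp.nondegenerate_even
    hp.nondegenerate_odd (by simp [finrank_eq_card_basis f]) fun x hx hxy => ?_
  obtain ⟨a, ha⟩ : ∃ a : Fin k → ℂ, x = ∑ i, a i • (e i : V) := by
    refine ⟨fun i => e.repr ⟨x, hx⟩ i, ?_⟩
    have := congrArg V₀.subtype (e.sum_repr ⟨x, hx⟩)
    rw [map_sum] at this
    exact this.symm
  have h1 : a ᵥ* B = 0 := by
    ext j
    have := hxy (f j) (f j).2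
    simpa [ha, Matrix.vecMul, dotProduct] using this
  have h2 := hB a h1
  rw [ha]
  simpa [Matrix.one_apply, dotProduct] using h2

include hV in
-- On `V₀`, β x is h(Dx, ·) for odd x and β y is h(y, ·) for even y, so D can be read off the Gram
-- matrix.
theorem IsOddOperator.map_odd_eq {k : ℕ} (e : Basis (Fin k) ℂ V₀) {β h : LinearMap.BilinForm ℂ V}
    {D : Module.End ℂ V} (hD : IsOddOperator V₀ V₁ β h D) {x y : V} (hx : x ∈ V₁) (hy : y ∈ V₀)
    (hxy : ∀ i, β x (e i) = β y (e i)) : D x = y := by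
  have h0 : (β x).domRestrict V₀ = (β y).domRestrict V₀ := e.ext hxy
  refine sub_eq_zero.1 (hD.nondeg _ fun v => ?_)
  obtain ⟨a, ha, b, hb, rfl⟩ := exists_homogeneous_parts hV v
  have h1 : β x a = β y a := LinearMap.congr_fun h0 ⟨a, ha⟩
  rw [hD.apply_eq, hD.apply_eq, hD.odd_even x hx a ha, hD.odd_even _ (hD.map_even y hy) a ha,
    zero_add, add_zero] at h1
  rw [map_add, hD.even_odd _ (V₀.sub_mem (hD.map_odd x hx) hy) b hb, add_zero, map_sub,
    LinearMap.sub_apply, h1, sub_self]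

include hV in
theorem IsOddOperator.map_even_eq {m : ℕ} (f : Basis (Fin m) ℂ V₁) {β h : LinearMap.BilinForm ℂ V}
    {D : Module.End ℂ V} (hD : IsOddOperator V₀ V₁ β h D) {x y : V} (hx : x ∈ V₀) (hy : y ∈ V₁)
    (hxy : ∀ i, β x (f i) = β y (f i)) : D x = y := by
  have h0 : (β x).domRestrict V₁ = (β y).domRestrict V₁ := f.ext hxy
  refine sub_eq_zero.1 (hD.nondeg _ fun v => ?_)
  obtain ⟨a, ha, b, hb, rfl⟩ := exists_homogeneous_parts hV v
  have h1 : β x b = β y b := LinearMap.congr_fun h0 ⟨b, hb⟩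
  rw [hD.apply_eq, hD.apply_eq, hD.even_odd x hx b hb, hD.even_odd _ (hD.map_odd y hy) b hb,
    zero_add, add_zero] at h1
  rw [map_add, hD.odd_even _ (V₁.sub_mem (hD.map_even x hx) hy) a ha, zero_add, map_sub,
    LinearMap.sub_apply, h1, sub_self]

theorem isIrreducible_gramForm_three_four (e : Basis (Fin 3) ℂ V₀) (f : Basis (Fin 4) ℂ V₁) :
    IsIrreducible V₀ V₁ (gramForm hV e f !![1, 0, 0, 0; 0, 1, 1, 0; 0, 0, 0, Complex.I]) := by
  have : FiniteDimensional ℂ V := (homogeneousBasis hV e f).finiteDimensional_of_finite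
  have hp := isPreOscillator_gramForm hV e f _ (by decide) IsListed.B₅.ne_zero
  obtain ⟨h, D, hD⟩ := exists_isOddOperator hV hp.supersymmetric hp.nondegenerate_even
    hp.nondegenerate_odd
  have f0 : D (f 0) = e 0 := hD.map_odd_eq hV e (f 0).2 (e 0).2 <| by
    simp [forall_fin_three]
  have f1 : D (f 1) = e 1 := hD.map_odd_eq hV e (f 1).2 (e 1).2 <| by
    simp [forall_fin_three]
  have f2 : D (f 2) = e 1 := hD.map_odd_eq hV e (f 2).2 (e 1).2 <| by
    simp [forall_fin_three]
  have f3 : D (f 3) = Complex.I • (e 2 : V) :=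
    hD.map_odd_eq hV e (f 3).2 (V₀.smul_mem _ (e 2).2) <| by
      simp [forall_fin_three]
  have e0 : D (e 0) = -f 1 := hD.map_even_eq hV f (e 0).2 (V₁.neg_mem (f 1).2) <| by
    simp [forall_fin_four, blockJ]
  have e1 : D (e 1) = f 0 - f 3 :=
    hD.map_even_eq hV f (e 1).2 (V₁.sub_mem (f 0).2 (f 3).2) <| by
      simp [forall_fin_four, blockJ]
  have e2 : D (e 2) = Complex.I • (f 2 : V) :=
    hD.map_even_eq hV f (e 2).2 (V₁.smul_mem _ (f 2).2) <| by
      simp [forall_fin_four, blockJ]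
  -- The chain is f 0, e 0, -f 1, -e 1, f 3 - f 0, i e 2 - e 0, f 1 - f 2, and then 0.
  have hnil : D ^ 7 = 0 := by
    refine (homogeneousBasis hV e f).ext fun i => ?_
    rcases i with i | i <;> fin_cases i <;>
      simp [pow_succ, f0, f1, f2, f3, e0, e1, e2, smul_smul]
  refine isIrreducible_of_ker_le_span hD hp.supersymmetric ⟨7, hnil⟩ (z := (f 1 : V) - f 2) ?_
  intro v hv
  obtain ⟨a, b, rfl⟩ : ∃ (a : Fin 3 → ℂ) (b : Fin 4 → ℂ),
      v = ∑ i, a i • (e i : V) + ∑ j, b j • (f j : V) := by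
    refine ⟨fun i => (homogeneousBasis hV e f).repr v (Sum.inl i),
      fun j => (homogeneousBasis hV e f).repr v (Sum.inr j), ?_⟩
    have hv := (homogeneousBasis hV e f).sum_repr v
    rw [Fintype.sum_sum_type] at hv
    simpa only [homogeneousBasis_inl, homogeneousBasis_inr] using hv.symm
  rw [LinearMap.mem_ker] at hv
  -- The listed coefficients are the coordinates of D v in the homogeneous basis.
  have hli := Fintype.linearIndependent_iff.1 (homogeneousBasis hV e f).linearIndependent
    (Sum.elim ![b 0, b 1 + b 2, Complex.I * b 3] ![a 1, -a 0, Complex.I * a 2, -a 1]) (by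
      rw [← hv]
      simp [Fintype.sum_sum_type, Fin.sum_univ_three, Fin.sum_univ_four, f0, f1, f2, f3, e0, e1,
        e2]
      module)
  have b0 : b 0 = 0 := by simpa using hli (Sum.inl 0)
  have b1 : b 2 = -b 1 := eq_neg_of_add_eq_zero_right (by simpa using hli (Sum.inl 1))
  have b3 : b 3 = 0 := by simpa using hli (Sum.inl 2)
  have a0 : a 0 = 0 := by simpa using hli (Sum.inr 1)
  have a1 : a 1 = 0 := by simpa using hli (Sum.inr 0)
  have a2 : a 2 = 0 := by simpa using hli (Sum.inr 2)
  refine Submodule.mem_span_singleton.2 ⟨b 1, ?_⟩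
  simp [Fin.sum_univ_three, Fin.sum_univ_four, a0, a1, a2, b0, b1, b3, sub_eq_add_neg]

theorem IsListed.isIrreducible {k m : ℕ} {B : Matrix (Fin k) (Fin m) ℂ} (hB : IsListed k m B)
    (e : Basis (Fin k) ℂ V₀) (f : Basis (Fin m) ℂ V₁) :
    IsIrreducible V₀ V₁ (gramForm hV e f B) := by
  have h0 := hB.ne_zero
  cases hB with
  | B₁ =>
    refine isIrreducible_gramForm_of_isotropic hV e f _ h0 fun a ha => ?_
    have c0 := congrFun ha 0
    simp [Matrix.vecMul, dotProduct] at c0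
    simp [dotProduct, c0]
  | B₂ α hα =>
    refine isIrreducible_gramForm_of_isotropic hV e f _ h0 fun a ha => ?_
    have hα0 : α ≠ 0 := by
      rintro rfl
      simp [CPlus] at hα
    have c0 := congrFun ha 0
    have c1 := congrFun ha 1
    simp [Matrix.vecMul, dotProduct, Fin.sum_univ_two, hα0] at c0 c1
    simp [dotProduct, Fin.sum_univ_two, c0, c1]
  | B₃ =>
    refine isIrreducible_gramForm_of_isotropic hV e f _ h0 fun a ha => ?_
    have c0 := congrFun ha 0
    simp [Matrix.vecMul, dotProduct, Fin.sum_univ_two] at c0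
    simp only [dotProduct, Fin.sum_univ_two]
    -- This is a₀² + a₁² = (a₀ + i a₁)(a₀ - i a₁), whose first factor vanishes on the left kernel;
    -- `B₄` and `B₆` use the same factorisation.
    linear_combination (a 0 - a 1 * Complex.I) * c0 + a 1 ^ 2 * Complex.I_sq
  | B₄ =>
    refine isIrreducible_gramForm_of_isotropic hV e f _ h0 fun a ha => ?_
    have c0 := congrFun ha 0
    have c1 := congrFun ha 1
    simp [Matrix.vecMul, dotProduct, Fin.sum_univ_three] at c0 c1
    simp only [dotProduct, Fin.sum_univ_three]
    linear_combination a 0 * c0 + (a 1 - a 2 * Complex.I) * c1 + a 2 ^ 2 * Complex.I_sq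
  | B₅ => exact isIrreducible_gramForm_three_four hV e f
  | B₆ =>
    refine isIrreducible_gramForm_of_isotropic hV e f _ h0 fun a ha => ?_
    have c0 := congrFun ha 0
    have c1 := congrFun ha 1
    simp [Matrix.vecMul, dotProduct, Fin.sum_univ_four] at c0 c1
    simp only [dotProduct, Fin.sum_univ_four]
    linear_combination (a 0 - a 1 * Complex.I) * c0 + a 1 ^ 2 * Complex.I_sq +
      (a 2 - a 3 * Complex.I) * c1 + a 3 ^ 2 * Complex.I_sq

theorem IsPreOscillator.exists_isListed {β : LinearMap.BilinForm ℂ V}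
    (hβ : IsPreOscillator V₀ V₁ β) (hirr : IsIrreducible V₀ V₁ β) {k m : ℕ} (hdim : k + m ≤ 7)
    (e : Basis (Fin k) ℂ V₀) (f : Basis (Fin m) ℂ V₁) :
    ∃ B : Matrix (Fin k) (Fin m) ℂ, IsListed k m B ∧ FormEquiv V₀ V₁ β (gramForm hV e f B) := by
  have : FiniteDimensional ℂ V := (homogeneousBasis hV e f).finiteDimensional_of_finite
  obtain ⟨h, D, hD⟩ := exists_isOddOperator hV hβ.supersymmetric hβ.nondegenerate_even
    hβ.nondegenerate_odd
  rcases hD.isNilpotent_or_injective hV hirr with hnil | hinj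
  · refine hD.exists_isListed_of_isNilpotent hV hirr hβ.supersymmetric e f ?_ hnil ?_
    · simpa [finrank_eq_card_basis (homogeneousBasis hV e f)] using hdim
    · rintro rfl
      obtain ⟨a, ha, b, hb, hab⟩ := hβ.inhomogeneous.1
      refine hab ?_
      rw [hD.apply_eq, hD.even_odd a ha b hb]
      simp
  · exact hD.exists_isListed_of_injective hV hβ hdim e f hinj

end Irreducibility

end SuperForm

end

theorem mainTheorem1 {V : Type*} [AddCommGroup V] [Module ℂ V]
    (V₀ V₁ : Submodule ℂ V) (hV : IsCompl V₀ V₁) {k m : ℕ} (hdim : k + m ≤ 7)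
    (e : Module.Basis (Fin k) ℂ V₀) (f : Module.Basis (Fin m) ℂ V₁) :
    -- the listed forms are irreducible pre-oscillator forms, and the list is complete
    (∀ β : LinearMap.BilinForm ℂ V,
      (SuperForm.IsPreOscillator V₀ V₁ β ∧ SuperForm.IsIrreducible V₀ V₁ β) ↔
        ∃ B : Matrix (Fin k) (Fin m) ℂ, SuperForm.IsListed k m B ∧
          SuperForm.FormEquiv V₀ V₁ β (SuperForm.gramForm hV e f B)) ∧
    -- distinct listed forms are inequivalent
    (∀ B B' : Matrix (Fin k) (Fin m) ℂ,
      SuperForm.IsListed k m B → SuperForm.IsListed k m B' → B ≠ B' →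
        ¬ SuperForm.FormEquiv V₀ V₁ (SuperForm.gramForm hV e f B)
          (SuperForm.gramForm hV e f B')) ∧
    -- classifying the forms amounts to classifying the orbits of the matrices `B ≠ 0`
    (∀ β : LinearMap.BilinForm ℂ V, SuperForm.IsPreOscillator V₀ V₁ β ↔
      Even m ∧ ∃ B : Matrix (Fin k) (Fin m) ℂ, B ≠ 0 ∧
        SuperForm.FormEquiv V₀ V₁ β (SuperForm.gramForm hV e f B)) ∧
    (Even m → ∀ B B' : Matrix (Fin k) (Fin m) ℂ,
      SuperForm.FormEquiv V₀ V₁ (SuperForm.gramForm hV e f B) (SuperForm.gramForm hV e f B') ↔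
        SuperForm.SameOrbit B B') := by
  refine ⟨fun β => ⟨fun ⟨hβ, hirr⟩ => hβ.exists_isListed hV hirr hdim e f, ?_⟩, ?_,
    SuperForm.isPreOscillator_iff e f hV, SuperForm.formEquiv_gramForm_iff e f hV⟩
  · rintro ⟨B, hB, heq⟩
    exact ⟨(SuperForm.isPreOscillator_gramForm hV e f B hB.even hB.ne_zero).of_equiv heq.symm,
      (hB.isIrreducible hV e f).of_equiv heq.symm⟩
  · intro B B' hB hB' hne heq
    exact hne (hB.eq_of_sameOrbit hB'
      ((SuperForm.formEquiv_gramForm_iff e f hV hB.even B B').1 heq))
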